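/- Let $n\ge 1$ and let $\overline{\mathrm{GT}}_n$ be the set of Gelfand–Tsetlin patterns of depth $n$: all $(y^{(1)},\dots,y^{(n)})$ with $y^{(r)}\in\mathbb R^r$, $y^{(r)}_1\ge\dots\ge y^{(r)}_r$ and $y^{(r+1)}_j\ge y^{(r)}_j\ge y^{(r+1)}_{j+1}$ for $1\le j\le r\le n-1$. Let $\mathrm{GT}_n\subset\overline{\mathrm{GT}}_n$ be the subset of patterns for which $y^{(r)}_1>\dots>y^{(r)}_r$ on each level and $y^{(r+1)}_j>y^{(r)}_j\ge y^{(r+1)}_{j+1}$. Let $\Delta_n(y)=\prod_{1\le i<j\le n}(y_i-y_j)$ for $y\in\mathbb R^n$. Let $\phi_1,\dots,\phi_n:\mathbb R\to\mathbb R$ be measurable functions such that $$\Phi_n(y):=\Big(\prod_{k=1}^n\phi_k(y_k)\Big)\Delta_n(y)$$ is integrable over $\mathbb R^n$, and such that, for some constant $Z_n>0$, $$d\nu_n[y^{(1)},\dots,y^{(n)}]=\frac1{Z_n}\det\big[\phi_i(y^{(n)}_j)\big]_{i,j=1}^n\,dy^{(n)}\cdots dy^{(1)}$$ ($dy^{(r)}$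 being Lebesgue measure on $\mathbb R^r$) defines a probability measure on $\overline{\mathrm{GT}}_n$; in particular the determinant is nonnegative almost everywhere on $\overline{\mathrm{GT}}_n$. Put $B_n:=\int_{\mathbb R^n}\Phi_n(y)\,dy$, $\mathcal C_n:=\{y\in\mathbb R^n:y_1>\dots>y_n\}$ and $\mathfrak S_n\mathcal C_n:=\bigcup_{\sigma\in\mathfrak S_n}\sigma(\mathcal C_n)$, where $\mathfrak S_n$ permutes the coordinates. Then $B_n\ne0$ and $\nu_n$ is supported on $\mathrm{GT}_n$ (its complement is $\nu_n$-null). The integrals in the formula below converge absolutely. Moreover, the random point field on $\{1,\dots,n\}\times\mathbb R$ formed by the $N=\frac12n(n+1)$ particles $(r,y^{(r)}_j)$, $1\le j\le r\le n$, under $\nu_n$ is determinantal with respect to the product $\mu$ of counting measure and Lebesgue measure: there is a kernel $K_n:(\{1,\dots,n\}\times\mathbb R)^2\to\mathbb R$ such that for every $m\le N$ the function $(w_1,\dots,w_m)\mapsto\det[K_n(w_i,w_j)]_{i,j=1}^m$ is $\mu^m$-integrable and, for every Borel set $B\subset(\{1,\dots,n\}\times\mathbb R)^m$, its integral over $B$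 with respect to $\mu^m$ is the expected number of ordered $m$-tuples of distinct particles that lie in $B$. This kernel satisfies $$\begin{aligned}K_n((r,u),(s,v))={}&\frac1{B_n}\int_{\mathfrak S_n\mathcal C_n}dy\;\Phi_n(y)\sum_{j=1}^n1_{v\le u<y_j}\frac{(y_j-u)^{n-r-1}}{(n-r-1)!}\frac{\partial^{n-s}}{\partial v^{n-s}}\prod_{i\ne j}\frac{v-y_i}{y_j-y_i}\\&-\frac1{B_n}\int_{\mathfrak S_n\mathcal C_n}dy\;\Phi_n(y)\sum_{j=1}^n1_{v>u\ge y_j}\frac{(y_j-u)^{n-r-1}}{(n-r-1)!}\frac{\partial^{n-s}}{\partial v^{n-s}}\prod_{i\ne j}\frac{v-y_i}{y_j-y_i}\end{aligned}$$ for all $r\in\{1,\dots,n-1\}$, $s\in\{1,\dots,n\}$ and $u,v\in\mathbb R$. -/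

import Mathlib

open MeasureTheory
open scoped ENNReal

noncomputable section

/-! Random point fields with finitely many particles. -/

section PointField

variable {Ω ι E : Type*} [MeasurableSpace Ω] [Fintype ι] [DecidableEq ι] [MeasurableSpace E]

/-- `𝕄_m[B]`: the expected number of `m`-tuples of distinct particles that lie in `B`.  The random
configuration has one particle `x ω i` for each label `i : ι`. -/
def tupleMeasure (P : Measure Ω) (x : Ω → ι → E) (m : ℕ) (B : Set (Fin m → E)) : ℝ≥0∞ :=
  ∫⁻ ω, ∑ i : Fin m ↪ ι, B.indicator (fun _ => (1 : ℝ≥0∞)) (fun k => x ω (i k)) ∂P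

/-- `ρ` is the `m`-th correlation function with respect to the reference measure `μ`:
`𝕄_m[B] = ∫_B ρ dμ^m` for all measurable `B`. -/
structure IsCorrelationFunction (P : Measure Ω) (x : Ω → ι → E) (μ : Measure E) (m : ℕ)
    (ρ : (Fin m → E) → ℝ) : Prop where
  integrable : Integrable ρ (Measure.pi fun _ : Fin m => μ)
  ne_top : ∀ B : Set (Fin m → E), MeasurableSet B → tupleMeasure P x m B ≠ ∞
  eq_integral : ∀ B : Set (Fin m → E), MeasurableSet B →
    (tupleMeasure P x m B).toReal = ∫ y in B, ρ y ∂(Measure.pi fun _ : Fin m => μ)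

/-- The random point field `x` (under `P`) is determinantal with correlation kernel `K`: for every
`m` up to the number of particles, the `m`-th correlation function exists and is
`det [K (y_i, y_j)]`. -/
structure IsDeterminantal (P : Measure Ω) (x : Ω → ι → E) (μ : Measure E) (K : E → E → ℝ) :
    Prop where
  isProbabilityMeasure : IsProbabilityMeasure P
  measurable : Measurable x
  correlation : ∀ m : ℕ, m ≤ Fintype.card ι →
    IsCorrelationFunction P x μ m
      (fun y => Matrix.det (Matrix.of fun i j : Fin m => K (y i) (y j)))

end PointField

/-! Gelfand–Tsetlin patterns. -/

/-- Arrays `(y^{(1)}, …, y^{(n)})` with `y^{(r)} ∈ ℝ^r`.  The index `r : Fin n` stands for level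
`r + 1`, so `y r j` is the particle `y^{(r+1)}_{j+1}`. -/
abbrev GTArray (n : ℕ) : Type := (r : Fin n) → Fin (r.val + 1) → ℝ

/-- The top level `y^{(n)}`. -/
def topLevel {n : ℕ} (y : GTArray n) (j : Fin n) : ℝ :=
  y ⟨n - 1, by have := j.isLt; omega⟩ ⟨j.val, by have := j.isLt; show j.val < n - 1 + 1; omega⟩

/-- The closed set of Gelfand–Tsetlin patterns of depth `n`: every level is weakly decreasing, and
`y^{(r+1)}_j ≥ y^{(r)}_j ≥ y^{(r+1)}_{j+1}`. -/
def closedGT (n : ℕ) : Set (GTArray n) :=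
  {y | (∀ r : Fin n, Antitone (y r)) ∧
    ∀ (r : ℕ) (h : r + 1 < n) (j : Fin (r + 1)),
      y ⟨r, by omega⟩ j ≤ y ⟨r + 1, h⟩ j.castSucc ∧ y ⟨r + 1, h⟩ j.succ ≤ y ⟨r, by omega⟩ j}

/-- The asymmetrically interlaced patterns of depth `n`: every level is strictly decreasing, and
`y^{(r+1)}_j > y^{(r)}_j ≥ y^{(r+1)}_{j+1}`. -/
def strictGT (n : ℕ) : Set (GTArray n) :=
  {y | (∀ r : Fin n, StrictAnti (y r)) ∧
    ∀ (r : ℕ) (h : r + 1 < n) (j : Fin (r + 1)),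
      y ⟨r, by omega⟩ j < y ⟨r + 1, h⟩ j.castSucc ∧ y ⟨r + 1, h⟩ j.succ ≤ y ⟨r, by omega⟩ j}

/-- `det [φ_i (y_j^{(n)})]`. -/
def topDet {n : ℕ} (φ : Fin n → ℝ → ℝ) (y : GTArray n) : ℝ :=
  Matrix.det (Matrix.of fun i j : Fin n => φ i (topLevel y j))

/-- The measure `ν_n` with density `Z⁻¹ det [φ_i (y_j^{(n)})]` on the closed set of Gelfand–Tsetlin
patterns with respect to `dy^{(n)} ⋯ dy^{(1)}`. -/
def gtMeasure {n : ℕ} (φ : Fin n → ℝ → ℝ) (Z : ℝ) : Measure (GTArray n) :=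
  ((volume : Measure (GTArray n)).restrict (closedGT n)).withDensity
    fun y => ENNReal.ofReal (Z⁻¹ * topDet φ y)

/-- The `n (n + 1) / 2` particles `(r, y^{(r)}_j)` of an array; the space `{1, …, n} × ℝ` is
`Fin n × ℝ`, where `r : Fin n` stands for level `r + 1`. -/
def gtParticles {n : ℕ} (y : GTArray n) (p : Σ r : Fin n, Fin (r.val + 1)) : Fin n × ℝ :=
  (p.1, y p.1 p.2)

/-- Counting measure times Lebesgue measure. -/
def levelMeasure (n : ℕ) : Measure (Fin n × ℝ) :=
  (Measure.count : Measure (Fin n)).prod volume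

/-! The kernel. -/

/-- `Δ_n(y) = ∏_{i < j} (y_i - y_j)`. -/
def vandermondeDelta {n : ℕ} (y : Fin n → ℝ) : ℝ :=
  ∏ i : Fin n, ∏ j ∈ Finset.Ioi i, (y i - y j)

/-- `Φ_n(y) = (∏_k φ_k(y_k)) Δ_n(y)`. -/
def PhiFn {n : ℕ} (φ : Fin n → ℝ → ℝ) (y : Fin n → ℝ) : ℝ :=
  (∏ k : Fin n, φ k (y k)) * vandermondeDelta y

/-- `B_n = ∫ Φ_n`. -/
def BConst {n : ℕ} (φ : Fin n → ℝ → ℝ) : ℝ := ∫ y : Fin n → ℝ, PhiFn φ y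

/-- `C_n = {y_1 > ⋯ > y_n}`. -/
def chamber (n : ℕ) : Set (Fin n → ℝ) := {y | StrictAnti y}

/-- The union of the images of `C_n` under all permutations of the coordinates. -/
def permChamber (n : ℕ) : Set (Fin n → ℝ) :=
  ⋃ σ : Equiv.Perm (Fin n), (fun y => y ∘ σ) '' chamber n

/-- `∂^{n-s}/∂v^{n-s} ∏_{i ≠ j} (v - y_i) / (y_j - y_i)`. -/
def lagrangeDeriv {n : ℕ} (s : ℕ) (y : Fin n → ℝ) (j : Fin n) (v : ℝ) : ℝ :=
  iteratedDeriv (n - s) (fun w : ℝ => ∏ i ∈ Finset.univ.erase j, (w - y i) / (y j - y i)) v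

/-- The integrand of the first integral in the kernel, between the levels `r` and `s`
(numbered from `1` to `n`). -/
def upperIntegrand {n : ℕ} (φ : Fin n → ℝ → ℝ) (r s : ℕ) (u v : ℝ) (y : Fin n → ℝ) : ℝ :=
  PhiFn φ y * ∑ j : Fin n,
    (if v ≤ u ∧ u < y j then (1 : ℝ) else 0) *
      ((y j - u) ^ (n - r - 1) / ((n - r - 1).factorial : ℝ)) * lagrangeDeriv s y j v

/-- The integrand of the second integral in the kernel, between the levels `r` and `s`
(numbered from `1` to `n`). -/
def lowerIntegrand {n : ℕ} (φ : Fin n → ℝ → ℝ) (r s : ℕ) (u v : ℝ) (y : Fin n → ℝ) : ℝ :=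
  PhiFn φ y * ∑ j : Fin n,
    (if u < v ∧ y j ≤ u then (1 : ℝ) else 0) *
      ((y j - u) ^ (n - r - 1) / ((n - r - 1).factorial : ℝ)) * lagrangeDeriv s y j v

end

/-! Number the levels `0, …, n - 1`. On sorted arrays the indicator of interlacing between
consecutive levels is the determinant of the steps `1_{u < v}`, bordered by a row of ones (a virtual
particle), and the top level contributes `det [φ_i (y_j)]`. As in the Eynard–Mehta theorem, this
product is, up to a constant, the determinant at all particles of the kernel `K((r,u),(s,v)) =
-W_{s-r}(u,v) + ∑_q Ψ_q(r,u) p_q(s,v)`, where `W_k` is the kernel of the `k`-fold antiderivative,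
`p_q(s,v) = v^(s-q)/(s-q)!`, and the `Ψ_q` are dual to the `p_q` through the inverse of the moment
matrix. Antiderivatives are based at `0`: the correction `1_{u < 0}` does not depend on `x`, so the
row of ones absorbs it, and it gives `stepKernel` compact support in `u`, which makes the
compositions converge.

The kernel is not a projection: `∫ K(w,x) K(x,z) dμ(x) = (l(w) - l(z) + 1) K(w,z)` with `l` the
level (`integral_extendedKernel_mul`). The level differences cancel inside determinants, and the
trace is the number `N` of particles, so integrating one point out of the determinant at `m + 1`
points leaves `N - m` times the determinant at `m` points (`integral_det_cons`). It remains to match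
the determinant at `N` points with the density up to a constant (`det_density_particleTuple`). This
takes its value at sorted arrays (`det_extendedKernel_particles_of_strictAnti`) and its vanishing at
all other configurations (`exists_array_of_det_ne_zero`). Descending to `m = 0` shows that the
constant is one, so no normalization is computed.

The analytic input is that integrability of `Φ_n` gives each `φ_k` moments up to order `n - 1`
(`integrable_moment`), and that the moment determinant, a nonzero multiple of `B_n`, does not vanish
(`det_momentMatrix_ne_zero`). Lagrange interpolation and Cramer's rule turn the integrals against
`Φ_n` into sums with the inverse moment matrix (`integral_PhiFn_mul_sum_lagrangeDeriv`). Splitting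
the step at `v` then yields the stated formula, with the term `-W_{s-r}` cancelled
(`extendedKernel_eq_integral`). -/

/-! One-variable kernels. -/

/-- The kernel of `f ↦ (x ↦ ∫ u in 0..x, f u)`. -/
noncomputable def stepKernel (u x : ℝ) : ℝ := (if u < x then 1 else 0) - (if u < 0 then 1 else 0)

/-- The kernel of the `k`-th iterated antiderivative based at `0`, with the convention that it
vanishes for `k = 0`. -/
noncomputable def splineKernel : ℕ → ℝ → ℝ → ℝ
  | 0, _, _ => 0
  | k + 1, u, x => stepKernel u x * ((x - u) ^ k / (k.factorial : ℝ))

/-- The normalized monomial `v ^ (s - q) / (s - q)!`, and zero if `s < q`. -/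
noncomputable def levelMonomial (q s : ℕ) (v : ℝ) : ℝ :=
  if q ≤ s then v ^ (s - q) / ((s - q).factorial : ℝ) else 0

/-- Euler's Beta integral, by induction on `b` and integration by parts. The oriented interval
allows either order of `u` and `v`. -/
theorem integral_sub_pow_mul_sub_pow (b : ℕ) : ∀ (a : ℕ) (u v : ℝ),
    ∫ y in u..v, (y - u) ^ a / (a.factorial : ℝ) * ((v - y) ^ b / (b.factorial : ℝ)) =
      (v - u) ^ (a + b + 1) / ((a + b + 1).factorial : ℝ) := by
  have hd : ∀ (a : ℕ) (u y : ℝ), HasDerivAt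
      (fun y : ℝ => (y - u) ^ (a + 1) / ((a + 1).factorial : ℝ))
      ((y - u) ^ a / (a.factorial : ℝ)) y := by
    intro a u y
    have h := (((hasDerivAt_id y).sub_const u).pow (a + 1)).div_const ((a + 1).factorial : ℝ)
    refine HasDerivAt.congr_deriv h ?_
    have : (a.factorial : ℝ) ≠ 0 := by positivity
    rw [Nat.factorial_succ]; push_cast; simp; field_simp
  induction b with
  | zero =>
    intro a u v
    have := intervalIntegral.integral_eq_sub_of_hasDerivAt (a := u) (b := v)
      (fun y _ => hd a u y) (by apply Continuous.intervalIntegrable; fun_prop)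
    simp at this ⊢
    rw [← this]
  | succ b ih =>
    intro a u v
    have hd2 : ∀ y : ℝ, HasDerivAt (fun y : ℝ => (v - y) ^ (b + 1) / ((b + 1).factorial : ℝ))
        (-((v - y) ^ b / (b.factorial : ℝ))) y := by
      intro y
      have h := (((hasDerivAt_id y).const_sub v).pow (b + 1)).div_const ((b + 1).factorial : ℝ)
      refine HasDerivAt.congr_deriv h ?_
      have : (b.factorial : ℝ) ≠ 0 := by positivity
      rw [Nat.factorial_succ]; push_cast; simp; field_simp
    have key := intervalIntegral.integral_eq_sub_of_hasDerivAt (a := u) (b := v)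
      (fun y _ => (hd a u y).mul (hd2 y)) (by apply Continuous.intervalIntegrable; fun_prop)
    rw [intervalIntegral.integral_add (by apply Continuous.intervalIntegrable; fun_prop)
      (by apply Continuous.intervalIntegrable; fun_prop)] at key
    simp only [mul_neg, intervalIntegral.integral_neg, ih (a + 1) u v] at key
    simp at key
    have e : a + 1 + b + 1 = a + (b + 1) + 1 := by ring
    rw [e] at key
    linarith

theorem stepKernel_eq_indicator (x : ℝ) (g : ℝ → ℝ) :
    (fun y => g y * stepKernel y x) =
      fun y => (Set.Ico 0 x).indicator g y - (Set.Ico x 0).indicator g y := by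
  funext y
  simp only [stepKernel, Set.indicator, Set.mem_Ico]
  split_ifs <;> first | ring1 | (exfalso; grind)

theorem integrable_mul_stepKernel (x : ℝ) {g : ℝ → ℝ} (hg : LocallyIntegrable g) :
    Integrable (fun y => g y * stepKernel y x) := by
  rw [stepKernel_eq_indicator]
  have h : ∀ a b : ℝ, Integrable ((Set.Ico a b).indicator g) := fun a b =>
    ((hg.integrableOn_isCompact isCompact_Icc).mono_set Set.Ico_subset_Icc_self).integrable_indicator
      measurableSet_Ico
  exact (h 0 x).sub (h x 0)

theorem integral_mul_stepKernel (x : ℝ) {g : ℝ → ℝ} (hg : LocallyIntegrable g) :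
    ∫ y, g y * stepKernel y x = ∫ y in (0 : ℝ)..x, g y := by
  rw [stepKernel_eq_indicator]
  have h : ∀ a b : ℝ, Integrable ((Set.Ico a b).indicator g) := fun a b =>
    ((hg.integrableOn_isCompact isCompact_Icc).mono_set Set.Ico_subset_Icc_self).integrable_indicator
      measurableSet_Ico
  rw [integral_sub (h _ _) (h _ _), integral_indicator measurableSet_Ico,
    integral_indicator measurableSet_Ico, integral_Ico_eq_integral_Ioc,
    integral_Ico_eq_integral_Ioc]
  rfl

/-- For `u ≥ 0` the product of the two steps is the indicator of `(u, v)`, for `u < 0` that of `[v,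
u]`. The factor `stepKernel u v` is the matching sign, and it is zero when that interval is on the
wrong side. -/
theorem integral_stepKernel_mul_stepKernel (u v : ℝ) (g : ℝ → ℝ) :
    ∫ y, stepKernel u y * g y * stepKernel y v = stepKernel u v * ∫ y in u..v, g y := by
  rcases le_or_gt 0 u with hu | hu
  · have : (fun y => stepKernel u y * g y * stepKernel y v) = (Set.Ioo u v).indicator g := by
      funext y
      simp only [stepKernel, Set.indicator, Set.mem_Ioo]
      split_ifs <;> first | ring1 | (exfalso; grind)
    rw [this, integral_indicator measurableSet_Ioo, ← integral_Ioc_eq_integral_Ioo]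
    rcases lt_or_ge u v with h | h
    · rw [intervalIntegral.integral_of_le h.le]
      simp [stepKernel, h, not_lt.2 hu]
    · simp [stepKernel, not_lt.2 hu, not_lt.2 h]
  · have : (fun y => stepKernel u y * g y * stepKernel y v) = (Set.Icc v u).indicator g := by
      funext y
      simp only [stepKernel, Set.indicator, Set.mem_Icc]
      split_ifs <;> first | ring1 | (exfalso; grind)
    rw [this, integral_indicator measurableSet_Icc, integral_Icc_eq_integral_Ioc]
    rcases lt_or_ge u v with h | h
    · simp [stepKernel, hu, h, not_lt.2 h.le]
    · rw [intervalIntegral.integral_of_ge h]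
      simp [stepKernel, hu, not_lt.2 h]

/-! ### Measurability and growth of the kernels -/

@[fun_prop]
theorem measurable_stepKernel : Measurable (fun p : ℝ × ℝ => stepKernel p.1 p.2) := by
  unfold stepKernel
  refine Measurable.sub (Measurable.ite (measurableSet_lt measurable_fst measurable_snd)
    measurable_const measurable_const) (Measurable.ite (measurableSet_lt measurable_fst
    measurable_const) measurable_const measurable_const)

theorem measurable_splineKernel (k : ℕ) :
    Measurable (fun p : ℝ × ℝ => splineKernel k p.1 p.2) := by
  cases k with
  | zero => exact measurable_const
  | succ k =>
    unfold splineKernel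
    fun_prop

theorem abs_stepKernel_le_one (u x : ℝ) : |stepKernel u x| ≤ 1 := by
  unfold stepKernel
  split_ifs <;> norm_num

theorem stepKernel_eq_zero {u x : ℝ} (h : |x| < |u|) : stepKernel u x = 0 := by
  unfold stepKernel
  split_ifs with h1 h2 h2
  · ring
  · rw [abs_of_nonneg (not_lt.1 h2), abs_lt] at h; linarith
  · rw [abs_of_neg h2, abs_lt] at h; linarith
  · ring

theorem abs_splineKernel_le (k : ℕ) (u x : ℝ) :
    |splineKernel (k + 1) u x| ≤ (1 + |u|) ^ k * (1 + |x|) ^ k := by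
  have h1 : |x - u| ≤ (1 + |u|) * (1 + |x|) := by
    have := abs_sub x u
    nlinarith [abs_nonneg x, abs_nonneg u]
  have h2 : (1 : ℝ) ≤ (k.factorial : ℝ) := by exact_mod_cast k.factorial_pos
  rw [splineKernel, abs_mul, abs_div, abs_pow, Nat.abs_cast, ← mul_pow]
  calc _ ≤ 1 * (|x - u| ^ k / (k.factorial : ℝ)) := by
        gcongr; exact abs_stepKernel_le_one _ _
    _ ≤ |x - u| ^ k := by rw [one_mul]; exact div_le_self (by positivity) h2
    _ ≤ _ := by gcongr

theorem abs_splineKernel_le_indicator (k : ℕ) (u x : ℝ) :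
    |splineKernel (k + 1) u x| ≤
      (Set.Icc (-|x|) |x|).indicator (fun _ => 2 ^ k * (1 + |x|) ^ k) u := by
  by_cases h : u ∈ Set.Icc (-|x|) |x|
  · rw [Set.indicator_of_mem h]
    have h0 : |u| ≤ |x| := abs_le.2 h
    have h1 : |x - u| ≤ 2 * (1 + |x|) := by
      have := abs_sub x u
      nlinarith [abs_nonneg x, abs_nonneg u]
    have h2 : (1 : ℝ) ≤ (k.factorial : ℝ) := by exact_mod_cast k.factorial_pos
    rw [splineKernel, abs_mul, abs_div, abs_pow, Nat.abs_cast, ← mul_pow]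
    calc _ ≤ 1 * (|x - u| ^ k / (k.factorial : ℝ)) := by
          gcongr; exact abs_stepKernel_le_one _ _
      _ ≤ |x - u| ^ k := by rw [one_mul]; exact div_le_self (by positivity) h2
      _ ≤ _ := by gcongr
  · rw [Set.indicator_of_notMem h]
    have h0 : |x| < |u| := by
      by_contra h'
      exact h (abs_le.1 (not_lt.1 h'))
    simp [splineKernel, stepKernel_eq_zero h0]

/-- Iterated antiderivatives compose. -/
theorem integral_splineKernel_mul_splineKernel {a b : ℕ} (ha : 1 ≤ a) (hb : 1 ≤ b) (u v : ℝ) :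
    ∫ y, splineKernel a u y * splineKernel b y v = splineKernel (a + b) u v := by
  obtain ⟨a, rfl⟩ := Nat.exists_eq_add_of_le' ha
  obtain ⟨b, rfl⟩ := Nat.exists_eq_add_of_le' hb
  have : ∀ y, splineKernel (a + 1) u y * splineKernel (b + 1) y v = stepKernel u y *
      ((y - u) ^ a / (a.factorial : ℝ) * ((v - y) ^ b / (b.factorial : ℝ))) * stepKernel y v := by
    intro y; simp only [splineKernel]; ring
  simp_rw [this]
  rw [integral_stepKernel_mul_stepKernel, integral_sub_pow_mul_sub_pow,
    show a + 1 + (b + 1) = (a + b + 1) + 1 by ring]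
  rfl

/-- Antiderivatives based at `0` take normalized monomials to normalized monomials. The condition
matters for `t < q ≤ t + b`, where the integrand vanishes but the raised monomial does not. -/
theorem integral_levelMonomial_mul_splineKernel (q t : ℕ) {b : ℕ} (hb : 1 ≤ b) (x : ℝ) :
    ∫ y, levelMonomial q t y * splineKernel b y x =
      if q ≤ t then levelMonomial q (t + b) x else 0 := by
  obtain ⟨b, rfl⟩ := Nat.exists_eq_add_of_le' hb
  by_cases h : q ≤ t
  · have : ∀ y, levelMonomial q t y * splineKernel (b + 1) y x =
      ((y - 0) ^ (t - q) / ((t - q).factorial : ℝ) * ((x - y) ^ b / (b.factorial : ℝ))) *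
        stepKernel y x := by
      intro y; simp only [splineKernel, levelMonomial, h, if_true, sub_zero]; ring
    simp_rw [this]
    rw [integral_mul_stepKernel _ (by apply Continuous.locallyIntegrable; fun_prop),
      integral_sub_pow_mul_sub_pow, if_pos h, levelMonomial, if_pos (by omega)]
    rw [show t + (b + 1) - q = t - q + b + 1 by omega, sub_zero]
  · simp [levelMonomial, h]

@[fun_prop]
theorem continuous_levelMonomial (q s : ℕ) : Continuous (levelMonomial q s) := by
  unfold levelMonomial
  split_ifs <;> fun_prop

theorem abs_levelMonomial_le (q s : ℕ) (v : ℝ) : |levelMonomial q s v| ≤ (1 + |v|) ^ (s - q) := by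
  unfold levelMonomial
  split_ifs
  · have h2 : (1 : ℝ) ≤ ((s - q).factorial : ℝ) := by exact_mod_cast (s - q).factorial_pos
    rw [abs_div, abs_pow, Nat.abs_cast]
    calc _ ≤ |v| ^ (s - q) := div_le_self (by positivity) h2
      _ ≤ _ := by gcongr; linarith
  · simp; positivity

/-! The measure on levels. -/

theorem levelMeasure_eq_sum (n : ℕ) :
    levelMeasure n = ∑ t : Fin n, (volume : Measure ℝ).map (Prod.mk t) := by
  unfold levelMeasure Measure.count
  rw [Measure.prod_sum_left, Measure.sum_fintype]
  simp [Measure.dirac_prod]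

instance (n : ℕ) : SigmaFinite (levelMeasure n) := by unfold levelMeasure; infer_instance

theorem integrable_levelMeasure_iff {n : ℕ} {f : Fin n × ℝ → ℝ} :
    Integrable f (levelMeasure n) ↔ ∀ t, Integrable fun y => f (t, y) := by
  rw [levelMeasure_eq_sum, integrable_finsetSum_measure]
  simp only [Finset.mem_univ, true_imp_iff]
  exact forall_congr' fun t => (measurableEmbedding_prodMk_left t).integrable_map_iff

theorem integral_levelMeasure {n : ℕ} {f : Fin n × ℝ → ℝ} (hf : Integrable f (levelMeasure n)) :
    ∫ z, f z ∂(levelMeasure n) = ∑ t, ∫ y, f (t, y) := by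
  rw [levelMeasure_eq_sum] at *
  rw [integral_finsetSum_measure (by simpa using integrable_finsetSum_measure.1 hf)]
  exact Finset.sum_congr rfl fun t _ => (measurableEmbedding_prodMk_left t).integral_map _

/-! Iterated antiderivatives acting on functions with moments. -/

/-- `∫ W_b(u, x) φ(x) dx` for the spline kernel `W_b`, which is read as the identity for `b = 0`. -/
noncomputable def splineTransform (φ : ℝ → ℝ) (b : ℕ) (u : ℝ) : ℝ :=
  if b = 0 then φ u else ∫ x, splineKernel b u x * φ x

/-- `∫ g(y) W_b(y, x) dy` for the spline kernel `W_b`, which is read as the identity for `b = 0`. -/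
noncomputable def splineAntiderivative (g : ℝ → ℝ) (b : ℕ) (x : ℝ) : ℝ :=
  if b = 0 then g x else ∫ y, g y * splineKernel b y x

theorem integrable_mul_of_moment {φ : ℝ → ℝ} {d : ℕ} (hm : Measurable φ)
    (hd : Integrable fun x => (1 + |x|) ^ d * φ x) {g : ℝ → ℝ} (hg : Measurable g) {C : ℝ} {a : ℕ}
    (hC : ∀ y, |g y| ≤ C * (1 + |y|) ^ a) (had : a ≤ d) : Integrable fun x => g x * φ x := by
  have h0 : 0 ≤ C := by
    have := hC 0
    simp at this
    exact (abs_nonneg _).trans this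
  refine (hd.norm.const_mul C).mono' (by fun_prop) (.of_forall fun x => ?_)
  have h1 : (0 : ℝ) ≤ 1 + |x| := by positivity
  simp only [norm_mul, Real.norm_eq_abs, abs_pow, abs_of_nonneg h1]
  calc |g x| * |φ x| ≤ C * (1 + |x|) ^ a * |φ x| := by gcongr; exact hC x
    _ ≤ C * (1 + |x|) ^ d * |φ x| := by
      gcongr
      linarith [abs_nonneg x]
    _ = _ := by ring

theorem integral_abs_mul_splineKernel_le {g : ℝ → ℝ} {C : ℝ} {a : ℕ} (b : ℕ) (h0 : 0 ≤ C)
    (hC : ∀ y, |g y| ≤ C * (1 + |y|) ^ a) (x : ℝ) :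
    ∫ y, |g y * splineKernel (b + 1) y x| ≤ (C * 2 ^ (b + 1)) * (1 + |x|) ^ (a + (b + 1)) := by
  have h1 : (0 : ℝ) ≤ |x| := abs_nonneg x
  have hle : ∀ y, |g y * splineKernel (b + 1) y x| ≤ (Set.Icc (-|x|) |x|).indicator
      (fun _ => C * (1 + |x|) ^ a * (2 ^ b * (1 + |x|) ^ b)) y := by
    intro y
    have h2 := abs_splineKernel_le_indicator b y x
    by_cases hy : y ∈ Set.Icc (-|x|) |x|
    · rw [Set.indicator_of_mem hy] at h2 ⊢
      rw [abs_mul]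
      have h3 : |y| ≤ |x| := abs_le.2 hy
      have : |g y| ≤ C * (1 + |x|) ^ a := (hC y).trans (by gcongr)
      gcongr
    · rw [Set.indicator_of_notMem hy] at h2 ⊢
      rw [abs_eq_zero.1 (h2.antisymm (abs_nonneg _))]
      simp
  refine (integral_mono_of_nonneg (.of_forall fun y => abs_nonneg _)
    ((integrable_indicator_iff measurableSet_Icc).2 (integrableOn_const (by simp))) (.of_forall hle)).trans ?_
  rw [integral_indicator measurableSet_Icc, setIntegral_const, measureReal_def, Real.volume_Icc,
    ENNReal.toReal_ofReal (by linarith), smul_eq_mul]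
  calc (|x| - -|x|) * (C * (1 + |x|) ^ a * (2 ^ b * (1 + |x|) ^ b))
      ≤ (2 * (1 + |x|)) * (C * (1 + |x|) ^ a * (2 ^ b * (1 + |x|) ^ b)) := by
        gcongr; linarith
    _ = _ := by ring

theorem integrable_mul_splineKernel {g : ℝ → ℝ} (hg : Measurable g) {C : ℝ} {a : ℕ} (b : ℕ)
    (hC : ∀ y, |g y| ≤ C * (1 + |y|) ^ a) (x : ℝ) :
    Integrable fun y => g y * splineKernel b y x := by
  cases b with
  | zero => simp [splineKernel]
  | succ b =>
    have hloc : LocallyIntegrable fun y => g y * ((x - y) ^ b / (b.factorial : ℝ)) := by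
      have hc : Continuous fun y : ℝ => C * (1 + |y|) ^ a * |(x - y) ^ b / (b.factorial : ℝ)| := by
        fun_prop
      refine hc.locallyIntegrable.mono (by fun_prop) (.of_forall fun y => ?_)
      rw [norm_mul, Real.norm_eq_abs, Real.norm_eq_abs, Real.norm_eq_abs]
      refine le_trans ?_ (le_abs_self _)
      gcongr
      exact hC y
    refine (integrable_mul_stepKernel x hloc).congr (.of_forall fun y => ?_)
    simp only [splineKernel]
    ring

theorem integrable_splineKernel_prod {φ : ℝ → ℝ} {d : ℕ} (hm : Measurable φ)
    (hd : Integrable fun x => (1 + |x|) ^ d * φ x) {g : ℝ → ℝ} (hg : Measurable g) {C : ℝ} {a b : ℕ}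
    (hC : ∀ y, |g y| ≤ C * (1 + |y|) ^ a) (had : a + (b + 1) ≤ d) :
    Integrable (fun p : ℝ × ℝ => g p.1 * splineKernel (b + 1) p.1 p.2 * φ p.2)
      (volume.prod volume) := by
  have h0 : 0 ≤ C := by
    have := hC 0
    simp at this
    exact (abs_nonneg _).trans this
  have hmeas : Measurable (fun p : ℝ × ℝ => g p.1 * splineKernel (b + 1) p.1 p.2) :=
    (hg.comp measurable_fst).mul (measurable_splineKernel _)
  have hmeas' : Measurable (fun p : ℝ × ℝ => g p.1 * splineKernel (b + 1) p.1 p.2 * φ p.2) := by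
    fun_prop
  rw [integrable_prod_iff' hmeas'.aestronglyMeasurable]
  refine ⟨.of_forall fun x => (integrable_mul_splineKernel hg (b + 1) hC x).mul_const (φ x), ?_⟩
  have h1 := (integrable_mul_of_moment hm hd (g := fun x => ∫ y, |g y * splineKernel (b + 1) y x|)
    (hmeas.abs.stronglyMeasurable.integral_prod_left').measurable (a := a + (b + 1)) (fun y => by
      rw [abs_of_nonneg (integral_nonneg fun y => abs_nonneg _)]
      exact integral_abs_mul_splineKernel_le b h0 hC y) had).norm
  refine h1.congr (.of_forall fun x => ?_)
  simp only [norm_mul _ (φ x), integral_mul_const]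
  rw [Real.norm_of_nonneg (integral_nonneg fun y => abs_nonneg _)]
  rfl

/-- Fubini moves the antiderivative from `φ` to `g`. A kernel of order `b` raises polynomial growth
by `b`, so moments of order `a + b` suffice for absolute convergence. -/
theorem mul_splineTransform {φ : ℝ → ℝ} {d : ℕ} (hm : Measurable φ)
    (hd : Integrable fun x => (1 + |x|) ^ d * φ x) {g : ℝ → ℝ} (hg : Measurable g) {C : ℝ} {a b : ℕ}
    (hC : ∀ y, |g y| ≤ C * (1 + |y|) ^ a) (had : a + b ≤ d) :
    Integrable (fun y => g y * splineTransform φ b y) ∧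
      ∫ y, g y * splineTransform φ b y = ∫ x, splineAntiderivative g b x * φ x := by
  cases b with
  | zero => simpa [splineTransform, splineAntiderivative] using
      integrable_mul_of_moment hm hd hg hC had
  | succ b =>
    have h := integrable_splineKernel_prod hm hd hg hC had
    simp only [splineTransform, splineAntiderivative, Nat.succ_ne_zero, if_false,
      ← integral_const_mul, ← integral_mul_const, ← mul_assoc]
    exact ⟨h.integral_prod_left, integral_integral_swap h⟩

/-! The extended kernel. -/

section ExtendedKernel

variable {n : ℕ}

/-- The moments `∫ x ^ (n - 1 - q) / (n - 1 - q)! φ_j(x) dx`. -/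
noncomputable def momentMatrix (φ : Fin n → ℝ → ℝ) : Matrix (Fin n) (Fin n) ℝ :=
  Matrix.of fun j q => ∫ x, levelMonomial q (n - 1) x * φ j x

/-- The functions on level `r` dual to the monomials. -/
noncomputable def dualFunction (φ : Fin n → ℝ → ℝ) (q : Fin n) (w : Fin n × ℝ) : ℝ :=
  ∑ j, (momentMatrix φ)⁻¹ q j * splineTransform (φ j) (n - 1 - w.1) w.2

/-- The difference of levels is truncated and `splineKernel 0` is zero, so the first term is present
only if `z` lies on a strictly higher level than `w`. -/
noncomputable def extendedKernel (φ : Fin n → ℝ → ℝ) (w z : Fin n × ℝ) : ℝ :=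
  -splineKernel (z.1 - w.1) w.2 z.2 + ∑ q, dualFunction φ q w * levelMonomial q z.1 z.2

variable {φ : Fin n → ℝ → ℝ} (hm : ∀ j, Measurable (φ j))
  (hd : ∀ j, Integrable fun x => (1 + |x|) ^ (n - 1) * φ j x)

include hm hd

theorem integral_mul_dualFunction {g : ℝ → ℝ} (hg : Measurable g) {C : ℝ} {a : ℕ}
    (hC : ∀ y, |g y| ≤ C * (1 + |y|) ^ a) {t : Fin n} (hat : a ≤ t) (q : Fin n) :
    Integrable (fun y => g y * dualFunction φ q (t, y)) ∧
      ∫ y, g y * dualFunction φ q (t, y) =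
        ∑ j, (momentMatrix φ)⁻¹ q j * ∫ x, splineAntiderivative g (n - 1 - t) x * φ j x := by
  have h := fun j => mul_splineTransform (hm j) (hd j) hg hC (b := n - 1 - t) (by omega)
  have e : (fun y => g y * dualFunction φ q (t, y)) = fun y =>
      ∑ j, (momentMatrix φ)⁻¹ q j * (g y * splineTransform (φ j) (n - 1 - t) y) := by
    funext y
    simp only [dualFunction, Finset.mul_sum]
    exact Finset.sum_congr rfl fun j _ => by ring
  rw [e]
  refine ⟨integrable_finsetSum _ fun j _ => (h j).1.const_mul _, ?_⟩
  rw [integral_finsetSum _ fun j _ => (h j).1.const_mul _]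
  exact Finset.sum_congr rfl fun j _ => by rw [integral_const_mul, (h j).2]

/-- Biorthogonality: the antiderivative carries the monomial from level `t` to the top level, where
its integrals against the `φ_j` are a column of the moment matrix `M`. What remains is an entry of
`M⁻¹ M`. -/
theorem integral_levelMonomial_mul_dualFunction (hdet : (momentMatrix φ).det ≠ 0) (q q' t : Fin n) :
    Integrable (fun y => levelMonomial q t y * dualFunction φ q' (t, y)) ∧
      ∫ y, levelMonomial q t y * dualFunction φ q' (t, y) = if q ≤ t ∧ q = q' then 1 else 0 := by
  have h := integral_mul_dualFunction hm hd (continuous_levelMonomial q t).measurable (C := 1)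
    (fun y => by simpa using abs_levelMonomial_le q t y) (t := t) (by omega) q'
  refine ⟨h.1, h.2.trans ?_⟩
  have e : splineAntiderivative (levelMonomial q t) (n - 1 - t) =
      fun x => if q ≤ t then levelMonomial q (n - 1) x else 0 := by
    funext x
    unfold splineAntiderivative
    split_ifs with h1 h2 h2
    · rw [show (n - 1) = t by omega]
    · simp [levelMonomial, Fin.le_def.not.1 h2]
    · rw [integral_levelMonomial_mul_splineKernel _ _ (by omega), if_pos (Fin.le_def.1 h2),
        show (t + (n - 1 - t) : ℕ) = n - 1 by omega]
    · rw [integral_levelMonomial_mul_splineKernel _ _ (by omega), if_neg (Fin.le_def.not.1 h2)]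
  rw [e]
  by_cases h1 : q ≤ t
  · have := congrFun (congrFun (Matrix.nonsing_inv_mul _ (isUnit_iff_ne_zero.2 hdet)) q') q
    simp only [Matrix.mul_apply, Matrix.one_apply] at this
    simp only [h1, if_true, true_and, eq_comm (a := q), ← this]
    rfl
  · simp [h1]

/-- `W_{t-r}` followed by `W_{n-1-t}` is `W_{n-1-r}`, so the dual functions are carried down from
level to level. -/
theorem integral_splineKernel_mul_dualFunction {r t : Fin n} (hrt : r < t) (u : ℝ) (q : Fin n) :
    Integrable (fun y => splineKernel (t - r) u y * dualFunction φ q (t, y)) ∧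
      ∫ y, splineKernel (t - r) u y * dualFunction φ q (t, y) = dualFunction φ q (r, u) := by
  have hrt' := Fin.lt_def.1 hrt
  have h := integral_mul_dualFunction hm hd (t := t) (a := (t - r - 1 : ℕ))
    (C := (1 + |u|) ^ (t - r - 1 : ℕ)) (g := splineKernel (t - r) u)
    ((measurable_splineKernel _).comp measurable_prodMk_left)
    (fun y => by
      have := abs_splineKernel_le (t - r - 1) u y
      rwa [show (t - r - 1 + 1 : ℕ) = t - r by omega] at this) (by omega) q
  refine ⟨h.1, h.2.trans (Finset.sum_congr rfl fun j _ => ?_)⟩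
  congr 1
  simp only [splineTransform]
  rw [if_neg (by omega)]
  congr 1
  funext x
  congr 1
  unfold splineAntiderivative
  split_ifs with h1
  · congr 1; omega
  · rw [integral_splineKernel_mul_splineKernel (by omega) (by omega)]
    congr 1; omega

/-- The product has four terms: `W` with `W` survives strictly between the two levels, `W` with `Ψ`
above `w`, `p` with `W` below `z`, and `p` with `Ψ` by biorthogonality. Below the level of `z` the
last two cancel, as both retain exactly the indices `q ≤ t`. -/
theorem integral_extendedKernel_mul_level (hdet : (momentMatrix φ).det ≠ 0) (w z : Fin n × ℝ)
    (t : Fin n) :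
    Integrable (fun y => extendedKernel φ w (t, y) * extendedKernel φ (t, y) z) ∧
      ∫ y, extendedKernel φ w (t, y) * extendedKernel φ (t, y) z =
        (if w.1 < t ∧ t < z.1 then splineKernel (z.1 - w.1) w.2 z.2 else 0) -
        (if w.1 < t then ∑ q, dualFunction φ q w * levelMonomial q z.1 z.2 else 0) +
        (if z.1 ≤ t then ∑ q, dualFunction φ q w * levelMonomial q z.1 z.2 else 0) := by
  obtain ⟨r, u⟩ := w
  obtain ⟨s, v⟩ := z
  simp only [extendedKernel]
  have h1 : ∀ q, Integrable (fun y => splineKernel (t - r) u y * dualFunction φ q (t, y)) ∧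
      ∫ y, splineKernel (t - r) u y * dualFunction φ q (t, y) =
        if r < t then dualFunction φ q (r, u) else 0 := by
    intro q
    split_ifs with hrt
    · exact integral_splineKernel_mul_dualFunction hm hd hrt u q
    · simp [show (t - r : ℕ) = 0 by omega, splineKernel]
  have h2 : ∀ q : Fin n, Integrable (fun y => levelMonomial q t y * splineKernel (s - t) y v) ∧
      ∫ y, levelMonomial q t y * splineKernel (s - t) y v =
        if t < s then (if q ≤ t then levelMonomial q s v else 0) else 0 := by
    intro q
    refine ⟨integrable_mul_splineKernel (by fun_prop) _ (C := 1)
      (fun y => by simpa using abs_levelMonomial_le q t y) v, ?_⟩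
    split_ifs with hts hq
    · rw [integral_levelMonomial_mul_splineKernel _ _ (by omega), if_pos (Fin.le_def.1 hq)]
      congr 1; omega
    · rw [integral_levelMonomial_mul_splineKernel _ _ (by omega), if_neg (Fin.le_def.not.1 hq)]
    · simp [show (s - t : ℕ) = 0 by omega, splineKernel]
  have h3 := fun q q' => integral_levelMonomial_mul_dualFunction hm hd hdet q q' t
  have h4 : Integrable (fun y => splineKernel (t - r) u y * splineKernel (s - t) y v) ∧
      ∫ y, splineKernel (t - r) u y * splineKernel (s - t) y v =
        if r < t ∧ t < s then splineKernel (s - r) u v else 0 := by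
    constructor
    · rcases Nat.eq_zero_or_pos (t - r : ℕ) with h0 | h0
      · simp [h0, splineKernel]
      · refine integrable_mul_splineKernel
          ((measurable_splineKernel _).comp measurable_prodMk_left) _
          (C := (1 + |u|) ^ (t - r - 1 : ℕ)) (a := (t - r - 1 : ℕ)) (fun y => ?_) v
        · have := abs_splineKernel_le (t - r - 1) u y
          rwa [show (t - r - 1 + 1 : ℕ) = t - r by omega] at this
    · split_ifs with h
      · rw [integral_splineKernel_mul_splineKernel (by omega) (by omega)]
        congr 1; omega
      · rcases not_and_or.1 h with h | h
        · simp [show (t - r : ℕ) = 0 by omega, splineKernel]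
        · simp [show (s - t : ℕ) = 0 by omega, splineKernel]
  have e : (fun y => (-splineKernel (t - r) u y + ∑ q : Fin n, dualFunction φ q (r, u) *
        levelMonomial q t y) * (-splineKernel (s - t) y v + ∑ q : Fin n, dualFunction φ q (t, y) *
        levelMonomial q s v)) = fun y =>
      splineKernel (t - r) u y * splineKernel (s - t) y v
      - (∑ q : Fin n, levelMonomial q s v * (splineKernel (t - r) u y * dualFunction φ q (t, y)))
      - (∑ q : Fin n, dualFunction φ q (r, u) * (levelMonomial q t y * splineKernel (s - t) y v))
      + ∑ q : Fin n, ∑ q' : Fin n, dualFunction φ q (r, u) * levelMonomial q' s v *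
          (levelMonomial q t y * dualFunction φ q' (t, y)) := by
    funext y
    have a1 : ∑ q : Fin n, levelMonomial q s v * (splineKernel (t - r) u y * dualFunction φ q (t, y)) =
        splineKernel (t - r) u y * ∑ q : Fin n, dualFunction φ q (t, y) * levelMonomial q s v := by
      rw [Finset.mul_sum]; exact Finset.sum_congr rfl fun q _ => by ring
    have a2 : ∑ q : Fin n, dualFunction φ q (r, u) * (levelMonomial q t y * splineKernel (s - t) y v) =
        (∑ q : Fin n, dualFunction φ q (r, u) * levelMonomial q t y) * splineKernel (s - t) y v := by
      rw [Finset.sum_mul]; exact Finset.sum_congr rfl fun q _ => by ring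
    have a3 : ∑ q : Fin n, ∑ q' : Fin n, dualFunction φ q (r, u) * levelMonomial q' s v *
          (levelMonomial q t y * dualFunction φ q' (t, y)) =
        (∑ q : Fin n, dualFunction φ q (r, u) * levelMonomial q t y) *
          ∑ q : Fin n, dualFunction φ q (t, y) * levelMonomial q s v := by
      rw [Finset.sum_mul_sum]
      exact Finset.sum_congr rfl fun q _ => Finset.sum_congr rfl fun q' _ => by ring
    rw [a1, a2, a3]
    ring
  have i1 := integrable_finsetSum Finset.univ fun q _ => (h1 q).1.const_mul (levelMonomial q s v)
  have i2 := integrable_finsetSum Finset.univ fun q _ =>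
    (h2 q).1.const_mul (dualFunction φ q (r, u))
  have i3 := integrable_finsetSum Finset.univ fun q _ => integrable_finsetSum Finset.univ
    fun q' _ => (h3 q q').1.const_mul (dualFunction φ q (r, u) * levelMonomial q' s v)
  rw [e]
  have j1 := h4.1.sub' i1
  have j2 := j1.sub' i2
  refine ⟨j2.fun_add i3, ?_⟩
  rw [integral_add j2 i3, integral_sub j1 i2, integral_sub h4.1 i1,
    integral_finsetSum _ fun q _ => (h1 q).1.const_mul (levelMonomial q s v),
    integral_finsetSum _ fun q _ => (h2 q).1.const_mul (dualFunction φ q (r, u)),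
    integral_finsetSum _ fun q _ => integrable_finsetSum Finset.univ
    fun q' _ => (h3 q q').1.const_mul (dualFunction φ q (r, u) * levelMonomial q' s v), h4.2]
  have b3 : ∀ q, ∫ y, ∑ q' : Fin n, dualFunction φ q (r, u) * levelMonomial q' s v *
          (levelMonomial q t y * dualFunction φ q' (t, y)) =
        if q ≤ t then dualFunction φ q (r, u) * levelMonomial q s v else 0 := by
    intro q
    rw [integral_finsetSum _ fun q' _ =>
      (h3 q q').1.const_mul (dualFunction φ q (r, u) * levelMonomial q' s v)]
    simp only [integral_const_mul, (h3 _ _).2]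
    by_cases h : q ≤ t <;> simp [h]
  simp only [b3, integral_const_mul, (h1 _).2, (h2 _).2]
  have b1 : ∑ q : Fin n, levelMonomial q s v * (if r < t then dualFunction φ q (r, u) else 0) =
      if r < t then ∑ q : Fin n, dualFunction φ q (r, u) * levelMonomial q s v else 0 := by
    split_ifs <;> simp [mul_comm]
  rw [b1]
  rcases lt_or_ge t s with h | h
  · simp only [h, if_true, not_le.2 h, if_false, mul_ite, mul_zero]
    ring
  -- On a level `t ≥ s` the restriction `q ≤ t` is void, since `p_q` vanishes on level `s` for `q >
  -- s`.
  · have b4 : ∀ q : Fin n, (if q ≤ t then dualFunction φ q (r, u) * levelMonomial q s v else 0) =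
        dualFunction φ q (r, u) * levelMonomial q s v := by
      intro q
      split_ifs with hq
      · rfl
      · rw [levelMonomial, if_neg (by omega), mul_zero]
    simp only [b4, not_lt.2 h, if_false, h, if_true, mul_zero, Finset.sum_const_zero]
    ring

/-- Summation counts levels: for `r < s`, `s - r - 1` of them lie strictly between, `n - 1 - r`
above `r`, and `n - s` from `s` upwards. Both parts of the kernel thus acquire the same factor `r -
s + 1`. -/
theorem integral_extendedKernel_mul (hdet : (momentMatrix φ).det ≠ 0) (w z : Fin n × ℝ) :
    Integrable (fun x => extendedKernel φ w x * extendedKernel φ x z) (levelMeasure n) ∧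
      ∫ x, extendedKernel φ w x * extendedKernel φ x z ∂(levelMeasure n) =
        ((w.1 : ℝ) - (z.1 : ℝ) + 1) * extendedKernel φ w z := by
  have h := integral_extendedKernel_mul_level hm hd hdet w z
  have hi : Integrable (fun x => extendedKernel φ w x * extendedKernel φ x z) (levelMeasure n) :=
    integrable_levelMeasure_iff.2 fun t => (h t).1
  refine ⟨hi, ?_⟩
  rw [integral_levelMeasure hi]
  simp only [(h _).2]
  obtain ⟨r, u⟩ := w
  obtain ⟨s, v⟩ := z
  simp only [extendedKernel, Finset.sum_add_distrib, Finset.sum_sub_distrib, ← Finset.sum_filter,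
    Finset.sum_const, nsmul_eq_mul]
  set S := ∑ q : Fin n, dualFunction φ q (r, u) * levelMonomial q s v
  have c1 : (Finset.univ.filter fun t : Fin n => r < t ∧ t < s).card = (s - r - 1 : ℕ) := by
    rw [← Fin.card_Ioo]; congr 1; ext; simp
  have c2 : (Finset.univ.filter fun t : Fin n => r < t).card = (n - 1 - r : ℕ) := by
    rw [← Fin.card_Ioi]; congr 1; ext; simp
  have c3 : (Finset.univ.filter fun t : Fin n => s ≤ t).card = (n - s : ℕ) := by
    rw [← Fin.card_Ici]; congr 1; ext; simp
  rw [c1, c2, c3, Nat.cast_sub (show (r : ℕ) ≤ n - 1 by omega), Nat.cast_sub s.isLt.le,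
    Nat.cast_sub (show 1 ≤ n by omega)]
  rcases lt_or_ge r s with hrs | hrs
  · rw [Nat.cast_sub (show 1 ≤ (s - r : ℕ) by omega), Nat.cast_sub (show (r : ℕ) ≤ s by omega)]
    push_cast
    ring
  · rw [show (s - r : ℕ) = 0 by omega]
    simp only [splineKernel]
    push_cast
    ring

/-- By biorthogonality level `t` contributes the number of indices `q ≤ t`, which is its number of
particles. -/
theorem integral_extendedKernel_diag (hdet : (momentMatrix φ).det ≠ 0) :
    Integrable (fun x => extendedKernel φ x x) (levelMeasure n) ∧
      ∫ x, extendedKernel φ x x ∂(levelMeasure n) =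
        (Fintype.card (Σ r : Fin n, Fin (r.val + 1)) : ℝ) := by
  have e : ∀ (t : Fin n) (y : ℝ), extendedKernel φ (t, y) (t, y) =
      ∑ q : Fin n, levelMonomial q t y * dualFunction φ q (t, y) := by
    intro t y
    simp [extendedKernel, splineKernel, mul_comm]
  have h := fun (t q : Fin n) => integral_levelMonomial_mul_dualFunction hm hd hdet q q t
  have hi : Integrable (fun x => extendedKernel φ x x) (levelMeasure n) :=
    integrable_levelMeasure_iff.2 fun t => by
      simp only [e]
      exact integrable_finsetSum _ fun q _ => (h t q).1
  refine ⟨hi, ?_⟩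
  rw [integral_levelMeasure hi, Fintype.card_sigma]
  simp only [e, Fintype.card_fin]
  push_cast
  refine Finset.sum_congr rfl fun t _ => ?_
  rw [integral_finsetSum _ fun q _ => (h t q).1]
  simp only [(h t _).2, and_true, Finset.sum_boole]
  have : (Finset.univ.filter fun q : Fin n => q ≤ t).card = (t + 1 : ℕ) := by
    rw [← Fin.card_Iic]; congr 1; ext; simp
  rw [this]; push_cast; ring

end ExtendedKernel

/-! Integrating out a point of a determinantal density. -/

/-- Expansion along both the first row and the first column, which isolates the dependence on the
point to be integrated out. -/
theorem Matrix.det_succ_eq_sub_sum_adjugate {R : Type*} [CommRing R] {m : ℕ}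
    (M : Matrix (Fin (m + 1)) (Fin (m + 1)) R) :
    M.det = M 0 0 * (M.submatrix Fin.succ Fin.succ).det -
      ∑ i : Fin m, ∑ j : Fin m, M i.succ 0 * M 0 j.succ *
        (M.submatrix Fin.succ Fin.succ).adjugate j i := by
  rw [Matrix.det_succ_row_zero, Fin.sum_univ_succ]
  have h0 : M.submatrix Fin.succ (Fin.succAbove 0) = M.submatrix Fin.succ Fin.succ := by
    ext; simp
  rw [h0, sub_eq_add_neg]
  congr 1
  · simp
  · rw [Finset.sum_comm, ← Finset.sum_neg_distrib]
    refine Finset.sum_congr rfl fun j _ => ?_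
    cases m with
    | zero => exact j.elim0
    | succ m =>
      rw [Matrix.det_succ_column_zero, Finset.mul_sum, ← Finset.sum_neg_distrib]
      refine Finset.sum_congr rfl fun i _ => ?_
      rw [Matrix.adjugate_fin_succ_eq_det_submatrix]
      have : (M.submatrix Fin.succ j.succ.succAbove).submatrix i.succAbove Fin.succ =
          (M.submatrix Fin.succ Fin.succ).submatrix i.succAbove j.succAbove := by
        ext a b
        simp
      rw [this]
      simp [pow_add, pow_succ]
      ring

section IntegrateOut

variable {E : Type*} [MeasurableSpace E]

/-- The matrix `K (x_i, x_j)`. -/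
def kernelMatrix (K : E → E → ℝ) {m : ℕ} (x : Fin m → E) : Matrix (Fin m) (Fin m) ℝ :=
  Matrix.of fun i j => K (x i) (x j)

/-- After the expansion the trace gives `N det P`, and the reproducing relation gives `∑ (l_i - l_j
+ 1) P_ij adj(P)_ji`. The summand `1` yields `m det P`, and the level differences cancel. -/
theorem integral_det_cons {μ : Measure E} {K : E → E → ℝ} {l : E → ℝ} {N : ℝ}
    (hK : ∀ w z, Integrable (fun x => K w x * K x z) μ ∧
      ∫ x, K w x * K x z ∂μ = (l w - l z + 1) * K w z)
    (hd : Integrable (fun x => K x x) μ ∧ ∫ x, K x x ∂μ = N) {m : ℕ} (x : Fin m → E) :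
    ∫ z, (kernelMatrix K (Fin.cons z x : Fin (m + 1) → E)).det ∂μ =
      (N - m) * (kernelMatrix K x).det := by
  set P := kernelMatrix K x with hP
  have e : ∀ z, (kernelMatrix K (Fin.cons z x : Fin (m + 1) → E)).det =
      K z z * P.det - ∑ i : Fin m, ∑ j : Fin m, K (x i) z * K z (x j) * P.adjugate j i := by
    intro z
    rw [Matrix.det_succ_eq_sub_sum_adjugate]
    rfl
  have i1 := fun i j => (hK (x i) (x j)).1.mul_const (P.adjugate j i)
  simp only [e]
  rw [integral_sub (hd.1.mul_const _) (integrable_finsetSum _ fun i _ =>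
    integrable_finsetSum _ fun j _ => i1 i j), integral_mul_const, hd.2,
    integral_finsetSum _ fun i _ => integrable_finsetSum _ fun j _ => i1 i j]
  have e2 : ∀ i, ∫ z, ∑ j : Fin m, K (x i) z * K z (x j) * P.adjugate j i ∂μ =
      ∑ j : Fin m, (l (x i) - l (x j) + 1) * (P i j * P.adjugate j i) := by
    intro i
    rw [integral_finsetSum _ fun j _ => i1 i j]
    refine Finset.sum_congr rfl fun j _ => ?_
    rw [integral_mul_const, (hK _ _).2, mul_assoc]
    rfl
  simp only [e2, add_mul, sub_mul, one_mul, Finset.sum_add_distrib, Finset.sum_sub_distrib,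
    ← Finset.mul_sum]
  have h1 : ∀ i, ∑ j, P i j * P.adjugate j i = P.det := by
    intro i
    have := congrFun (congrFun P.mul_adjugate i) i
    simpa [Matrix.mul_apply] using this
  -- Here `adj(P) P = det P` evaluates the sum over rows, as `P adj(P) = det P` did over columns in
  -- `h1`. The two weighted sums both equal `det P ∑ l (x i)`.
  have h2 : ∑ i, ∑ j, l (x j) * (P i j * P.adjugate j i) = ∑ j, l (x j) * P.det := by
    rw [Finset.sum_comm]
    refine Finset.sum_congr rfl fun j _ => ?_
    rw [← Finset.mul_sum]
    have := congrFun (congrFun P.adjugate_mul j) j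
    simp only [mul_comm (P _ _)]
    simp only [Matrix.mul_apply, Matrix.smul_apply, Matrix.one_apply_eq, smul_eq_mul, mul_one]
      at this
    rw [this]
  rw [h2]
  simp only [h1]
  simp

variable {Ω ι : Type*} [MeasurableSpace Ω] [Fintype ι] [DecidableEq ι]

-- A tuple of `m` distinct labels extends by one more label in `N - m` ways.
omit [MeasurableSpace E] in
theorem tupleMeasure_tail (P : Measure Ω) (x : Ω → ι → E) (m : ℕ) (B : Set (Fin m → E)) :
    tupleMeasure P x (m + 1) {y | Fin.tail y ∈ B} =
      (Fintype.card ι - m : ℕ) * tupleMeasure P x m B := by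
  unfold tupleMeasure
  rw [← lintegral_const_mul' _ _ (by simp)]
  congr 1
  funext ω
  rw [← (Equiv.embeddingFinSucc m ι).symm.sum_comp, Fintype.sum_sigma, Finset.mul_sum]
  refine Finset.sum_congr rfl fun e _ => ?_
  have : ∀ a : {i // i ∉ Set.range e},
      ({y : Fin (m + 1) → E | Fin.tail y ∈ B}.indicator (fun _ => (1 : ℝ≥0∞))
        fun k => x ω ((Equiv.embeddingFinSucc m ι).symm ⟨e, a⟩ k)) =
      B.indicator (fun _ => (1 : ℝ≥0∞)) fun k => x ω (e k) := by
    intro a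
    rfl
  simp only [this, Finset.sum_const, nsmul_eq_mul]
  congr 2
  rw [Finset.card_univ, Fintype.card_subtype_compl]
  congr 1
  exact (Fintype.card_congr (Equiv.ofInjective e e.injective).symm).trans (Fintype.card_fin m)

omit [MeasurableSpace E] [DecidableEq ι] in
theorem tupleMeasure_ne_top (P : Measure Ω) [IsFiniteMeasure P] (x : Ω → ι → E) (m : ℕ)
    (B : Set (Fin m → E)) : tupleMeasure P x m B ≠ ∞ := by
  refine ne_top_of_le_ne_top (b := (Fintype.card (Fin m ↪ ι) : ℝ≥0∞) * P Set.univ)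
    (ENNReal.mul_ne_top (by simp) (measure_ne_top _ _)) ?_
  rw [← lintegral_const]
  refine lintegral_mono fun ω => ?_
  refine (Finset.sum_le_card_nsmul _ _ (1 : ℝ≥0∞) fun i _ => ?_).trans (by simp)
  exact Set.indicator_apply_le' (fun _ => le_rfl) fun _ => zero_le_one

omit [MeasurableSpace E] [DecidableEq ι] in
theorem tupleMeasure_zero_univ (P : Measure Ω) [IsProbabilityMeasure P] (x : Ω → ι → E) :
    tupleMeasure P x 0 Set.univ = 1 := by
  have : Unique (Fin 0 ↪ ι) := ⟨⟨⟨Fin.elim0, fun a => a.elim0⟩⟩, fun e => by ext a; exact a.elim0⟩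
  simp [tupleMeasure]

/-- A determinantal density on tuples of points, with a kernel that reproduces itself up to the
difference of the levels `l` of its arguments, passes from `m + 1` points to `m` points. -/
theorem det_density_of_succ {μ : Measure E} [SigmaFinite μ] {K : E → E → ℝ} {l : E → ℝ}
    (P : Measure Ω) (x : Ω → ι → E) {c : ℝ} {m : ℕ} (hm : m < Fintype.card ι)
    (hK : ∀ w z, Integrable (fun x => K w x * K x z) μ ∧
      ∫ x, K w x * K x z ∂μ = (l w - l z + 1) * K w z)
    (hd : Integrable (fun x => K x x) μ ∧ ∫ x, K x x ∂μ = (Fintype.card ι : ℝ))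
    (h : Integrable (fun y : Fin (m + 1) → E => (kernelMatrix K y).det) (Measure.pi fun _ => μ) ∧
      ∀ B : Set (Fin (m + 1) → E), MeasurableSet B →
        ∫ y in B, (kernelMatrix K y).det ∂(Measure.pi fun _ => μ) =
          c * (tupleMeasure P x (m + 1) B).toReal) :
    Integrable (fun y : Fin m → E => (kernelMatrix K y).det) (Measure.pi fun _ => μ) ∧
      ∀ B : Set (Fin m → E), MeasurableSet B →
        ∫ y in B, (kernelMatrix K y).det ∂(Measure.pi fun _ => μ) =
          c * (tupleMeasure P x m B).toReal := by
  have hne : ((Fintype.card ι : ℝ) - m) ≠ 0 := by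
    rw [sub_ne_zero]; exact_mod_cast hm.ne'
  have hmp := (measurePreserving_piFinSuccAbove (fun _ : Fin (m + 1) => μ) 0).symm
  have hcons : ∀ (z : E) (y : Fin m → E),
      (MeasurableEquiv.piFinSuccAbove (fun _ : Fin (m + 1) => E) 0).symm (z, y) = Fin.cons z y := by
    intro z y
    simp [MeasurableEquiv.piFinSuccAbove]
    rfl
  have hi := (hmp.integrable_comp_emb (MeasurableEquiv.measurableEmbedding _)).2 h.1
  have hi2 := hi.integral_prod_right
  simp only [Function.comp_def, hcons, integral_det_cons hK hd] at hi2
  refine ⟨(hi2.const_mul ((Fintype.card ι : ℝ) - m)⁻¹).congr (.of_forall fun y => by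
    simp only []; field_simp), fun B hB => ?_⟩
  have hBt : MeasurableSet {y : Fin (m + 1) → E | Fin.tail y ∈ B} :=
    hB.preimage (measurable_pi_lambda _ fun i => measurable_pi_apply _)
  have h2 := h.2 _ hBt
  rw [tupleMeasure_tail, ENNReal.toReal_mul, ENNReal.toReal_natCast, Nat.cast_sub hm.le] at h2
  rw [← hmp.setIntegral_preimage_emb (MeasurableEquiv.measurableEmbedding _)] at h2
  have hpre : (MeasurableEquiv.piFinSuccAbove (fun _ : Fin (m + 1) => E) 0).symm ⁻¹'
      {y : Fin (m + 1) → E | Fin.tail y ∈ B} = Set.univ ×ˢ B := by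
    ext ⟨z, y⟩
    simp only [Set.mem_preimage, hcons, Set.mem_ofPred_eq, Fin.tail_cons, Set.mem_prod,
      Set.mem_univ, true_and]
  rw [hpre, ← Measure.prod_restrict, Measure.restrict_univ, integral_prod_symm _ (by
    have := hi.restrict (s := Set.univ ×ˢ B)
    rwa [← Measure.prod_restrict, Measure.restrict_univ] at this)] at h2
  simp only [hcons, integral_det_cons hK hd, integral_const_mul] at h2
  refine mul_left_cancel₀ hne (h2.trans ?_)
  ring

theorem isDeterminantal_of_det_density {μ : Measure E} [SigmaFinite μ] {K : E → E → ℝ} {l : E → ℝ}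
    (P : Measure Ω) [IsProbabilityMeasure P] {x : Ω → ι → E} (hx : Measurable x) {c : ℝ}
    (hK : ∀ w z, Integrable (fun x => K w x * K x z) μ ∧
      ∫ x, K w x * K x z ∂μ = (l w - l z + 1) * K w z)
    (hd : Integrable (fun x => K x x) μ ∧ ∫ x, K x x ∂μ = (Fintype.card ι : ℝ))
    (h : Integrable (fun y : Fin (Fintype.card ι) → E => (kernelMatrix K y).det)
        (Measure.pi fun _ => μ) ∧
      ∀ B : Set (Fin (Fintype.card ι) → E), MeasurableSet B →
        ∫ y in B, (kernelMatrix K y).det ∂(Measure.pi fun _ => μ) =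
          c * (tupleMeasure P x (Fintype.card ι) B).toReal) :
    IsDeterminantal P x μ K := by
  have key : ∀ m ≤ Fintype.card ι,
      Integrable (fun y : Fin m → E => (kernelMatrix K y).det) (Measure.pi fun _ => μ) ∧
      ∀ B : Set (Fin m → E), MeasurableSet B →
        ∫ y in B, (kernelMatrix K y).det ∂(Measure.pi fun _ => μ) =
          c * (tupleMeasure P x m B).toReal := by
    intro m hm
    induction hm using Nat.decreasingInduction with
    | self => exact h
    | of_succ m hm ih => exact det_density_of_succ P x hm hK hd ih
  -- For zero points the determinant and the number of tuples are both one, which fixes the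
  -- constant.
  have hc : c = 1 := by
    have := (key 0 (Nat.zero_le _)).2 Set.univ MeasurableSet.univ
    simpa [tupleMeasure_zero_univ, measureReal_def] using this.symm
  refine ⟨inferInstance, hx, fun m hm => ⟨(key m hm).1, fun B _ => tupleMeasure_ne_top P x m B,
    fun B hB => ?_⟩⟩
  have := (key m hm).2 B hB
  rw [hc, one_mul] at this
  exact this.symm

end IntegrateOut

/-! The determinant of the kernel at all particles of an array. -/

theorem Matrix.BlockTriangular.det_sigma {n : ℕ}
    {M : Matrix (Σ r : Fin n, Fin (r.val + 1)) (Σ r : Fin n, Fin (r.val + 1)) ℝ}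
    (hM : M.BlockTriangular Sigma.fst) :
    M.det = ∏ r : Fin n, (Matrix.of fun i j : Fin (r.val + 1) => M ⟨r, i⟩ ⟨r, j⟩).det := by
  rw [hM.det_fintype]
  refine Finset.prod_congr rfl fun r _ => ?_
  let f : Fin (r.val + 1) → {p : Σ r : Fin n, Fin (r.val + 1) // p.1 = r} := fun i => ⟨⟨r, i⟩, rfl⟩
  have hf : Function.Bijective f := by
    refine ⟨fun i j h => ?_, ?_⟩
    · simpa [f] using h
    · rintro ⟨⟨r', i⟩, rfl⟩
      exact ⟨i, rfl⟩
  rw [← Matrix.det_submatrix_equiv_self (Equiv.ofBijective f hf)]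
  rfl

/-- The matrix of the step functions at `u`, with a last row of ones. -/
noncomputable def interlacingMatrix {t : ℕ} (u : Fin t → ℝ) (v : Fin (t + 1) → ℝ) :
    Matrix (Fin (t + 1)) (Fin (t + 1)) ℝ :=
  Matrix.of fun i j => Fin.lastCases 1 (fun i' => stepKernel (u i') (v j)) i

/-- After the base point correction is removed, every row is an initial segment of ones, and these
segments grow with the row. A nonzero determinant forces their lengths to be `1, …, t + 1`, which is
interlacing; conversely interlacing makes the matrix lower unitriangular. -/
theorem det_interlacingMatrix {t : ℕ} {u : Fin t → ℝ} {v : Fin (t + 1) → ℝ} (hu : Antitone u)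
    (hv : StrictAnti v) [Decidable (∀ i, u i < v i.castSucc ∧ v i.succ ≤ u i)] :
    (interlacingMatrix u v).det = if ∀ i, u i < v i.castSucc ∧ v i.succ ≤ u i then 1 else 0 := by
  classical
  let B : Matrix (Fin (t + 1)) (Fin (t + 1)) ℝ := Matrix.of fun i j =>
    Fin.lastCases 1 (fun i' => if u i' < v j then 1 else 0) i
  have hB : (interlacingMatrix u v).det = B.det := by
    -- The correction `1_{u < 0}` is constant along a row, hence a multiple of the last row of ones.
    refine Matrix.det_eq_of_forall_row_eq_smul_add_const
      (fun i => Fin.lastCases 0 (fun i' => -(if u i' < 0 then 1 else 0)) i) (Fin.last t) ?_ ?_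
    · simp
    · intro i j
      refine Fin.lastCases ?_ (fun i => ?_) i
      · simp [interlacingMatrix, B]
      · simp [interlacingMatrix, B, stepKernel, sub_eq_add_neg]
  rw [hB]
  split_ifs with h
  · rw [Matrix.det_of_isLowerTriangular]
    · refine Finset.prod_eq_one fun i _ => ?_
      refine Fin.lastCases ?_ (fun i => ?_) i
      · simp [B]
      · simp [B, (h i).1]
    · intro i j hij
      have hij : i < j := hij
      revert hij
      refine Fin.lastCases (fun hij => ?_) (fun i hij => ?_) i
      · exact absurd hij (not_lt.2 (Fin.le_last _))
      · have : v j ≤ u i := (hv.antitone (Fin.le_def.2 (by have := Fin.lt_def.1 hij; simpa using this))).trans (h i).2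
        simp [B, not_lt.2 this]
  · by_contra hdet
    apply h
    let a : Fin (t + 1) → ℕ := fun i => (Finset.univ.filter fun j => B i j = 1).card
    have h01 : ∀ i j, B i j = 0 ∨ B i j = 1 := by
      intro i j
      refine Fin.lastCases ?_ (fun i => ?_) i
      · simp [B]
      · by_cases h : u i < v j <;> simp [B, h]
    have hdown : ∀ i j j', j ≤ j' → B i j' = 1 → B i j = 1 := by
      intro i j j' hj
      refine Fin.lastCases ?_ (fun i => ?_) i
      · simp [B]
      · simp only [B, Matrix.of_apply, Fin.lastCases_castSucc, ite_eq_left_iff, zero_ne_one,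
          imp_false, not_not]
        exact fun h => h.trans_le (hv.antitone hj)
    have hmono : ∀ i i' j, i ≤ i' → B i j = 1 → B i' j = 1 := by
      intro i i' j
      refine Fin.lastCases ?_ (fun i' => ?_) i'
      · simp [B]
      · refine Fin.lastCases (fun h => absurd h (not_le.2 (Fin.castSucc_lt_last _))) (fun i h => ?_) i
        simp only [B, Matrix.of_apply, Fin.lastCases_castSucc, ite_eq_left_iff, zero_ne_one,
          imp_false, not_not]
        exact fun h' => (hu (Fin.castSucc_le_castSucc_iff.1 h)).trans_lt h'
    have ha : ∀ i j, B i j = 1 ↔ j.val < a i := by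
      intro i j
      constructor
      · intro hj
        have : Finset.Iic j ⊆ Finset.univ.filter fun j => B i j = 1 := by
          intro j' hj'
          simpa using hdown i _ _ (Finset.mem_Iic.1 hj') hj
        have := Finset.card_le_card this
        rw [Fin.card_Iic] at this
        exact this
      · intro hj
        by_contra hne
        have : (Finset.univ.filter fun j => B i j = 1) ⊆ Finset.Iio j := by
          intro j' hj'
          rw [Finset.mem_Iio]
          by_contra hle
          exact hne (hdown i _ _ (not_lt.1 hle) (by simpa using hj'))
        have := Finset.card_le_card this
        rw [Fin.card_Iio] at this
        exact absurd hj (not_lt.2 this)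
    have hinj : ∀ i i', a i = a i' → i = i' := by
      intro i i' hii
      by_contra hne
      apply hdet
      refine Matrix.det_zero_of_row_eq hne (funext fun j => ?_)
      have := (ha i j).trans ((show j.val < a i ↔ j.val < a i' by rw [hii]).trans (ha i' j).symm)
      rcases h01 i j with h1 | h1
      · refine h1.trans ((h01 i' j).resolve_right fun h2 => ?_).symm
        exact zero_ne_one (h1.symm.trans (this.2 h2))
      · exact h1.trans (this.1 h1).symm
    have hpos : ∀ i, 0 < a i := by
      intro i
      by_contra hne
      apply hdet
      refine Matrix.det_eq_zero_of_row_eq_zero i fun j => ?_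
      refine (h01 i j).resolve_right fun h1 => ?_
      have := (ha i j).1 h1
      omega
    have hle : ∀ i, a i ≤ t + 1 := fun i => (Finset.card_le_univ _).trans (by simp)
    -- The lengths are positive, at most `t + 1` and pairwise distinct; shifted by one they form a
    -- strictly increasing self-map of `Fin (t + 1)`, hence the identity.
    let f : Fin (t + 1) → Fin (t + 1) := fun i => ⟨a i - 1, by have := hpos i; have := hle i; omega⟩
    have hf : StrictMono f := by
      refine Monotone.strictMono_of_injective (fun i i' hii => ?_) (fun i i' hii => ?_)
      · have : a i ≤ a i' := Finset.card_le_card fun j hj => by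
          simpa using hmono i i' j hii (by simpa using hj)
        exact Fin.le_def.2 (Nat.sub_le_sub_right this 1)
      · have h1 := hpos i
        have h2 := hpos i'
        have := congrArg Fin.val hii
        exact hinj i i' (by simp only [f] at this; omega)
    have hid : f = id := by
      refine (StrictMono.range_inj hf strictMono_id).1 ?_
      rw [(Finite.injective_iff_surjective.1 hf.injective).range_eq, Set.range_id]
    have hai : ∀ i, a i = i.val + 1 := by
      intro i
      have := congrArg Fin.val (congrFun hid i)
      have h1 := hpos i
      simp only [f, id] at this
      omega
    intro i
    have h1 := (ha i.castSucc i.castSucc).2 (by rw [hai]; simp)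
    have h2 := (ha i.castSucc i.succ).not.2 (by rw [hai]; simp)
    simp only [B, Matrix.of_apply, Fin.lastCases_castSucc, ite_eq_left_iff, zero_ne_one,
      imp_false, not_not, not_lt] at h1 h2
    exact ⟨not_le.1 h1, h2⟩

/-- The entries of an array, with the value zero outside of it. -/
noncomputable def gtEntry {n : ℕ} (y : GTArray n) (r i : ℕ) : ℝ :=
  if h : r < n ∧ i < r + 1 then y ⟨r, h.1⟩ ⟨i, h.2⟩ else 0

theorem gtEntry_eq {n : ℕ} (y : GTArray n) (r : Fin n) (i : Fin (r.val + 1)) :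
    gtEntry y r i = y r i := by
  rw [gtEntry, dif_pos ⟨r.isLt, i.isLt⟩]

section TopDeterminant

variable {n : ℕ} (φ : Fin (n + 1) → ℝ → ℝ) (y : GTArray (n + 1))

/-- The top level has as many particles as there are monomials, so its labels also serve as the
index `q` of the finite-rank part. They are free for this, since no spline starts from the top
level. -/
noncomputable def kernelLeftFactor :
    Matrix (Σ r : Fin (n + 1), Fin (r.val + 1)) (Σ r : Fin (n + 1), Fin (r.val + 1)) ℝ :=
  Matrix.of fun p p' => if h : p'.1 = Fin.last n then
    dualFunction φ ⟨p'.2, by have := p'.2.isLt; omega⟩ (gtParticles y p)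
    else if p = p' then -1 else 0

noncomputable def kernelRightFactor :
    Matrix (Σ r : Fin (n + 1), Fin (r.val + 1)) (Σ r : Fin (n + 1), Fin (r.val + 1)) ℝ :=
  Matrix.of fun p p' => if p.1 = Fin.last n then levelMonomial p.2 p'.1 (y p'.1 p'.2)
    else splineKernel (p'.1 - p.1) (y p.1 p.2) (y p'.1 p'.2)

theorem kernelLeftFactor_mul_kernelRightFactor :
    kernelLeftFactor φ y * kernelRightFactor y =
      Matrix.of fun p p' => extendedKernel φ (gtParticles y p) (gtParticles y p') := by
  ext p p'
  rw [Matrix.mul_apply, Fintype.sum_sigma, Fin.sum_univ_castSucc]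
  have h1 : ∀ r : Fin n, ∑ i : Fin (r.castSucc.val + 1), kernelLeftFactor φ y p ⟨r.castSucc, i⟩ *
      kernelRightFactor y ⟨r.castSucc, i⟩ p' = if p.1 = r.castSucc then
        -splineKernel (p'.1 - p.1) (y p.1 p.2) (y p'.1 p'.2) else 0 := by
    intro r
    obtain ⟨r', i'⟩ := p
    have hr : r.castSucc ≠ Fin.last n := (Fin.castSucc_lt_last r).ne
    by_cases h : r' = r.castSucc
    · subst h
      simp [kernelLeftFactor, kernelRightFactor, hr]
    · simp [kernelLeftFactor, kernelRightFactor, hr, h]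
  have h2 : ∀ i : Fin ((Fin.last n).val + 1), kernelLeftFactor φ y p ⟨Fin.last n, i⟩ *
      kernelRightFactor y ⟨Fin.last n, i⟩ p' =
        dualFunction φ i (gtParticles y p) * levelMonomial i p'.1 (y p'.1 p'.2) := by
    intro i
    simp [kernelLeftFactor, kernelRightFactor]
  simp only [h1, h2]
  rw [Matrix.of_apply, extendedKernel]
  congr 1
  obtain ⟨r, i⟩ := p
  refine Fin.lastCases (fun i => ?_) (fun r i => ?_) r i
  · have : (p'.1 - n : ℕ) = 0 := by have := p'.1.isLt; omega
    simp [(Fin.castSucc_lt_last _).ne', gtParticles, this, splineKernel]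
  · simp [gtParticles]

/-- The factor is block triangular by level, with blocks `-1` below the top. On the top level no
antiderivative remains, and the block is the transpose of `M⁻¹ [φ_i (y_j)]`. -/
theorem det_kernelLeftFactor :
    (kernelLeftFactor φ y).det = ((∏ r : Fin n, (-1 : ℝ) ^ (r.val + 1)) *
      ((momentMatrix φ)⁻¹).det) * topDet φ y := by
  have hbt : (kernelLeftFactor φ y).BlockTriangular Sigma.fst := by
    intro p p' h
    have h1 : p'.1 ≠ Fin.last n := (h.trans_le (Fin.le_last _)).ne
    have h2 : p ≠ p' := fun e => by rw [e] at h; exact lt_irrefl _ h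
    simp [kernelLeftFactor, h1, h2]
  rw [hbt.det_sigma, Fin.prod_univ_castSucc, mul_assoc]
  congr 1
  · refine Finset.prod_congr rfl fun r _ => ?_
    have : (Matrix.of fun i j : Fin (r.castSucc.val + 1) =>
        kernelLeftFactor φ y ⟨r.castSucc, i⟩ ⟨r.castSucc, j⟩) = -1 := by
      ext i j
      by_cases h : i = j <;>
        simp [kernelLeftFactor, (Fin.castSucc_lt_last r).ne, h]
    rw [this, Matrix.det_neg]
    simp
  · have : (Matrix.of fun i j : Fin ((Fin.last n).val + 1) =>
        kernelLeftFactor φ y ⟨Fin.last n, i⟩ ⟨Fin.last n, j⟩) =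
        ((momentMatrix φ)⁻¹ * Matrix.of fun i j : Fin (n + 1) => φ i (topLevel y j)).transpose := by
      ext i j
      simp [kernelLeftFactor, dualFunction, Matrix.mul_apply, gtParticles, splineTransform,
        topLevel]
      rfl
    rw [this, Matrix.det_transpose, Matrix.det_mul]
    rfl

/-- The particle, or virtual particle, whose row of the kernel stands in row `p` of the block
triangular form. -/
def blockRow (p : Σ r : Fin (n + 1), Fin (r.val + 1)) : Σ r : Fin (n + 1), Fin (r.val + 1) :=
  if h : p.2 = Fin.last p.1.val then ⟨Fin.last n, ⟨p.1, p.1.isLt⟩⟩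
  else ⟨⟨p.1 - 1, by have := p.1.isLt; omega⟩, ⟨p.2, by
    have h1 := Fin.val_lt_last h
    show p.2.val < p.1.val - 1 + 1
    omega⟩⟩

theorem blockRow_val (p : Σ r : Fin (n + 1), Fin (r.val + 1)) :
    (blockRow p).1.val = (if p.2.val = p.1.val then n else p.1.val - 1) ∧
      (blockRow p).2.val = (if p.2.val = p.1.val then p.1.val else p.2.val) := by
  have e : p.2 = Fin.last p.1.val ↔ p.2.val = p.1.val := by simp [Fin.ext_iff]
  by_cases h : p.2 = Fin.last p.1.val
  · rw [blockRow, dif_pos h, if_pos (e.1 h), if_pos (e.1 h)]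
    exact ⟨rfl, rfl⟩
  · rw [blockRow, dif_neg h, if_neg (e.not.1 h), if_neg (e.not.1 h)]
    exact ⟨rfl, rfl⟩

theorem blockRow_injective : Function.Injective (blockRow (n := n)) := by
  rintro p p' h
  have h1 := blockRow_val p
  have h2 := blockRow_val p'
  rw [h] at h1
  have b1 := p.1.isLt
  have b2 := p.2.isLt
  have b3 := p'.1.isLt
  have b4 := p'.2.isLt
  have key : p.1.val = p'.1.val ∧ p.2.val = p'.2.val := by
    obtain ⟨h1, h3⟩ := h1
    obtain ⟨h2, h4⟩ := h2
    rw [h1] at h2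
    rw [h3] at h4
    split_ifs at h2 h4 <;> omega
  obtain ⟨⟨r, hr⟩, ⟨i, hi⟩⟩ := p
  obtain ⟨⟨r', hr'⟩, ⟨i', hi'⟩⟩ := p'
  obtain ⟨rfl, rfl⟩ : r = r' ∧ i = i' := key
  rfl

/-- In the permuted order, row block `t` consists of the particles of level `t - 1` and the virtual
particle `t`. It vanishes on columns of lower level because `W_0 = 0` and `p_t` is zero there; on
level `t` itself `W_1` is the step and `p_t` is one. The constant is the sign of the permutation. -/
theorem det_kernelRightFactor : ∃ c : ℝ, ∀ y : GTArray (n + 1),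
    (kernelRightFactor y).det = c * ∏ t : Fin (n + 1), (interlacingMatrix
      (fun i : Fin t.val => gtEntry y (t - 1) i) (y t)).det := by
  let σ : Equiv.Perm (Σ r : Fin (n + 1), Fin (r.val + 1)) :=
    Equiv.ofBijective blockRow (Finite.injective_iff_bijective.1 blockRow_injective)
  refine ⟨((Equiv.Perm.sign σ : ℤ) : ℝ), fun y => ?_⟩
  have h1 := Matrix.det_permute σ (kernelRightFactor y)
  have h2 : (((Equiv.Perm.sign σ : ℤ) : ℝ)) * ((Equiv.Perm.sign σ : ℤ) : ℝ) = 1 := by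
    rw [← Int.cast_mul, Int.units_coe_mul_self]; simp
  have h3 : ∀ p p', (kernelRightFactor y).submatrix σ id p p' =
      if p.2 = Fin.last p.1.val then levelMonomial p.1 p'.1 (y p'.1 p'.2)
      else splineKernel (p'.1 - (p.1 - 1)) (gtEntry y (p.1 - 1) p.2) (y p'.1 p'.2) := by
    intro p p'
    show kernelRightFactor y (blockRow p) p' = _
    split_ifs with h
    · simp [blockRow, h, kernelRightFactor]
    · have h4 := Fin.val_lt_last h
      have h5 : p.1.val - 1 ≠ n := by have := p.1.isLt; omega
      rw [blockRow, dif_neg h]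
      simp only [kernelRightFactor, Matrix.of_apply]
      rw [if_neg (by simpa [Fin.ext_iff] using h5)]
      exact congrArg (fun z => splineKernel _ z _) (gtEntry_eq y _ _).symm
  have hbt : ((kernelRightFactor y).submatrix σ id).BlockTriangular Sigma.fst := by
    intro p p' h
    rw [h3]
    have h' := Fin.lt_def.1 h
    split_ifs with h4
    · rw [levelMonomial, if_neg (by omega)]
    · rw [show (p'.1 - (p.1 - 1) : ℕ) = 0 by omega, splineKernel]
  rw [hbt.det_sigma] at h1
  have h4 : ∀ t : Fin (n + 1), (Matrix.of fun i j : Fin (t.val + 1) =>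
      (kernelRightFactor y).submatrix σ id ⟨t, i⟩ ⟨t, j⟩) =
      interlacingMatrix (fun i : Fin t.val => gtEntry y (t - 1) i) (y t) := by
    intro t
    ext i j
    rw [Matrix.of_apply, h3]
    refine Fin.lastCases ?_ (fun i => ?_) i
    · simp [interlacingMatrix, levelMonomial]
    · have ht : (t - (t - 1) : ℕ) = 1 := by have := i.isLt; omega
      simp [interlacingMatrix, (Fin.castSucc_lt_last i).ne, ht, splineKernel]
  simp only [h4] at h1
  rw [h1, ← mul_assoc, h2, one_mul]

theorem det_extendedKernel_particles : ∃ c : ℝ, ∀ y : GTArray (n + 1),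
    (Matrix.of fun p p' => extendedKernel φ (gtParticles y p) (gtParticles y p')).det =
      c * topDet φ y * ∏ t : Fin (n + 1), (interlacingMatrix
        (fun i : Fin t.val => gtEntry y (t - 1) i) (y t)).det := by
  obtain ⟨c, hc⟩ := det_kernelRightFactor (n := n)
  refine ⟨((∏ r : Fin n, (-1 : ℝ) ^ (r.val + 1)) * ((momentMatrix φ)⁻¹).det) * c, fun y => ?_⟩
  rw [← kernelLeftFactor_mul_kernelRightFactor, Matrix.det_mul, hc, det_kernelLeftFactor]
  ring

end TopDeterminant

theorem mem_strictGT_iff {n : ℕ} {y : GTArray (n + 1)} (hy : ∀ r, StrictAnti (y r)) :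
    y ∈ strictGT (n + 1) ↔ ∀ t : Fin (n + 1), ∀ i : Fin t.val,
      gtEntry y (t - 1) i < y t i.castSucc ∧ y t i.succ ≤ gtEntry y (t - 1) i := by
  constructor
  · rintro ⟨-, h⟩ ⟨t, ht⟩ i
    cases t with
    | zero => exact i.elim0
    | succ t =>
      have := h t ht i
      rwa [← gtEntry_eq y ⟨t, by omega⟩ i] at this
  · intro h
    refine ⟨hy, fun r hr j => ?_⟩
    have := h ⟨r + 1, hr⟩ j
    rwa [← gtEntry_eq y ⟨r, by omega⟩ j]

/-- On arrays with sorted levels, the determinant of the kernel at all particles is the density of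
Gelfand–Tsetlin patterns up to a constant. -/
theorem det_extendedKernel_particles_of_strictAnti {n : ℕ} (φ : Fin (n + 1) → ℝ → ℝ) :
    ∃ c : ℝ, ∀ y : GTArray (n + 1), (∀ r, StrictAnti (y r)) →
      (Matrix.of fun p p' => extendedKernel φ (gtParticles y p) (gtParticles y p')).det =
        c * (strictGT (n + 1)).indicator (topDet φ) y := by
  classical
  obtain ⟨c, hc⟩ := det_extendedKernel_particles φ
  refine ⟨c, fun y hy => ?_⟩
  rw [hc, mul_assoc]
  congr 1
  have hanti : ∀ t : Fin (n + 1), Antitone fun i : Fin t.val => gtEntry y (t - 1) i := by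
    rintro ⟨t, ht⟩
    cases t with
    | zero => exact fun i => i.elim0
    | succ t =>
      intro i j hij
      exact (gtEntry_eq y ⟨t, by omega⟩ j).trans_le
        (((hy ⟨t, by omega⟩).antitone hij).trans (gtEntry_eq y ⟨t, by omega⟩ i).ge)
  have hprod : (∏ t : Fin (n + 1), (interlacingMatrix
        (fun i : Fin t.val => gtEntry y (t - 1) i) (y t)).det) =
      if y ∈ strictGT (n + 1) then 1 else 0 := by
    simp only [det_interlacingMatrix (hanti _) (hy _), mem_strictGT_iff hy]
    rw [Finset.prod_ite_zero]
    simp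
  rw [hprod]
  by_cases h : y ∈ strictGT (n + 1) <;> simp [h]

/-! Vanishing of the determinant unless level `s` holds `s + 1` points. -/

section Vanishing

variable {n m : ℕ} {φ : Fin n → ℝ → ℝ} {w : Fin m → Fin n × ℝ}

/-- On the columns of level at most `s`, every row of the kernel is a combination of the spline rows
from points below level `s` and the monomials with `q ≤ s`. More than `s + 1` points on level `s`
would make these columns outnumber the rows that span them, hence linearly dependent. -/
theorem card_level_le (h : (kernelMatrix (extendedKernel φ) w).det ≠ 0) (s : Fin n) :
    (Finset.univ.filter fun k => (w k).1 = s).card ≤ s + 1 := by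
  by_contra hcard
  let C := {k : Fin m // (w k).1 ≤ s}
  let R := {k : Fin m // (w k).1 < s} ⊕ {q : Fin n // q ≤ s}
  have hCR : Fintype.card R < Fintype.card C := by
    have h1 : Fintype.card {q : Fin n // q ≤ s} = s + 1 := by
      rw [Fintype.card_subtype, ← Fin.card_Iic]; congr 1; ext; simp
    have h2 : (Finset.univ.filter fun k => (w k).1 ≤ s) =
        (Finset.univ.filter fun k => (w k).1 < s) ∪ Finset.univ.filter fun k => (w k).1 = s := by
      ext k; simp [le_iff_lt_or_eq]
    rw [Fintype.card_sum, h1, Fintype.card_subtype, Fintype.card_subtype, h2,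
      Finset.card_union_of_disjoint]
    · omega
    · rw [Finset.disjoint_filter]
      exact fun k _ h1 h2 => h1.ne h2
  let L : Matrix R C ℝ := Matrix.of fun a c => Sum.elim
    (fun k : {k : Fin m // (w k).1 < s} => splineKernel ((w c.1).1 - (w k.1).1) (w k.1).2 (w c.1).2)
    (fun q : {q : Fin n // q ≤ s} => levelMonomial q.1 (w c.1).1 (w c.1).2) a
  obtain ⟨x, hx, hx0⟩ : ∃ x : C → ℝ, L.mulVec x = 0 ∧ x ≠ 0 := by
    have : LinearMap.ker L.mulVecLin ≠ ⊥ := LinearMap.ker_ne_bot_of_finrank_lt (by simpa using hCR)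
    obtain ⟨x, hx, hx0⟩ := (Submodule.ne_bot_iff _).1 this
    exact ⟨x, by simpa using hx, hx0⟩
  have hx1 : ∀ k, (w k).1 < s →
      ∑ c : C, splineKernel ((w c.1).1 - (w k).1) (w k).2 (w c.1).2 * x c = 0 :=
    fun k hk => congrFun hx (Sum.inl ⟨k, hk⟩)
  have hx2 : ∀ q, q ≤ s → ∑ c : C, levelMonomial q (w c.1).1 (w c.1).2 * x c = 0 :=
    fun q hq => congrFun hx (Sum.inr ⟨q, hq⟩)
  apply h
  rw [← Matrix.exists_mulVec_eq_zero_iff]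
  refine ⟨fun k => if hk : (w k).1 ≤ s then x ⟨k, hk⟩ else 0, fun h0 => hx0 ?_, ?_⟩
  · funext c
    have := congrFun h0 c.1
    simpa [c.2] using this
  · funext k
    have e : (kernelMatrix (extendedKernel φ) w).mulVec
        (fun k => if hk : (w k).1 ≤ s then x ⟨k, hk⟩ else 0) k =
        ∑ c : C, extendedKernel φ (w k) (w c.1) * x c := by
      rw [Matrix.mulVec, dotProduct]
      have h1 : ∀ k' ∈ Finset.univ.filter fun k' => ¬(w k').1 ≤ s,
          kernelMatrix (extendedKernel φ) w k k' *
            (if hk : (w k').1 ≤ s then x ⟨k', hk⟩ else 0) = 0 := by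
        intro k' hk'
        rw [dif_neg (Finset.mem_filter.1 hk').2, mul_zero]
      rw [← Finset.sum_filter_add_sum_filter_not _ fun k' => (w k').1 ≤ s,
        Finset.sum_eq_zero h1, add_zero, Finset.sum_subtype _ (p := fun k' => (w k').1 ≤ s)
        (by simp)]
      refine Finset.sum_congr rfl fun c _ => ?_
      rw [dif_pos c.2]
      rfl
    rw [e]
    simp only [extendedKernel, add_mul, neg_mul, Finset.sum_add_distrib, Finset.sum_neg_distrib,
      Finset.sum_mul]
    have e1 : ∑ c : C, splineKernel ((w c.1).1 - (w k).1) (w k).2 (w c.1).2 * x c = 0 := by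
      by_cases hk : (w k).1 < s
      · exact hx1 k hk
      · refine Finset.sum_eq_zero fun c _ => ?_
        have : ((w c.1).1 - (w k).1 : ℕ) = 0 := by have := c.2; omega
        rw [this, splineKernel, zero_mul]
    have e2 : ∑ c : C, ∑ q : Fin n, dualFunction φ q (w k) *
        levelMonomial q (w c.1).1 (w c.1).2 * x c = 0 := by
      rw [Finset.sum_comm]
      refine Finset.sum_eq_zero fun q _ => ?_
      simp only [mul_assoc, ← Finset.mul_sum]
      by_cases hq : q ≤ s
      · rw [hx2 q hq, mul_zero]
      · rw [Finset.sum_eq_zero, mul_zero]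
        intro c _
        rw [levelMonomial, if_neg (by have := c.2; omega), zero_mul]
    rw [e1, e2]
    simp

theorem injective_of_det_ne_zero {E : Type*} {K : E → E → ℝ} {x : Fin m → E}
    (h : (kernelMatrix K x).det ≠ 0) : Function.Injective x := by
  intro i j hij
  by_contra hne
  exact h (Matrix.det_zero_of_row_eq hne (by ext k; simp [kernelMatrix, hij]))

/-- Where the determinant of the kernel at the maximal number of points does not vanish, the points
are the particles of an array with sorted levels. -/
theorem exists_array_of_det_ne_zero {w : Fin (Fintype.card (Σ r : Fin n, Fin (r.val + 1))) →
    Fin n × ℝ} (h : (kernelMatrix (extendedKernel φ) w).det ≠ 0) :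
    ∃ (i : Fin (Fintype.card (Σ r : Fin n, Fin (r.val + 1))) ↪ (Σ r : Fin n, Fin (r.val + 1)))
      (y : GTArray n), (∀ r, StrictAnti (y r)) ∧ ∀ k, gtParticles y (i k) = w k := by
  classical
  have hinj := injective_of_det_ne_zero h
  -- The upper bounds `s + 1` add up to the total number of points, so each of them is attained.
  have hcard : ∀ s : Fin n, (Finset.univ.filter fun k => (w k).1 = s).card = s + 1 := by
    have hsum : ∑ s : Fin n, (Finset.univ.filter fun k => (w k).1 = s).card =
        ∑ s : Fin n, (s.val + 1) := by
      rw [← Finset.card_eq_sum_card_fiberwise (by simp)]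
      simp [Fintype.card_sigma]
    intro s
    exact (Finset.sum_eq_sum_iff_of_le fun s _ => card_level_le h s).1 hsum s (Finset.mem_univ s)
  let V : Fin n → Finset ℝ := fun s =>
    (Finset.univ.filter fun k => (w k).1 = s).image fun k => (w k).2
  have hV : ∀ s, (V s).card = s.val + 1 := by
    intro s
    rw [← hcard s]
    refine Finset.card_image_of_injOn fun k hk k' hk' hkk => hinj (Prod.ext ?_ hkk)
    have h1 : (w k).1 = s := by simpa using hk
    have h2 : (w k').1 = s := by simpa using hk'
    rw [h1, h2]
  let y : GTArray n := fun s j => (V s).orderEmbOfFin (hV s) (Fin.rev j)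
  have hy : ∀ k, ∃ j, y (w k).1 j = (w k).2 := by
    intro k
    have h1 : (w k).2 ∈ Set.range ((V (w k).1).orderEmbOfFin (hV _)) := by
      rw [Finset.range_orderEmbOfFin]
      exact Finset.mem_coe.2 (Finset.mem_image.2 ⟨k, by simp, rfl⟩)
    obtain ⟨j, hj⟩ := h1
    exact ⟨Fin.rev j, by simpa [y] using hj⟩
  choose j hj using hy
  have hpart : ∀ k, gtParticles y ⟨(w k).1, j k⟩ = w k := fun k => Prod.ext rfl (hj k)
  refine ⟨⟨fun k => ⟨(w k).1, j k⟩, fun k k' hkk => hinj ?_⟩, y, fun r a b hab => ?_, hpart⟩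
  · rw [← hpart k, ← hpart k']
    exact congrArg (gtParticles y) hkk
  · exact ((V r).orderEmbOfFin (hV r)).strictMono (Fin.rev_lt_rev.2 hab)

end Vanishing

/-! Measure theory of Gelfand–Tsetlin arrays. -/

section Arrays

variable {n : ℕ}

theorem measurable_array_apply (r : Fin n) (j : Fin (r.val + 1)) :
    Measurable fun y : GTArray n => y r j :=
  (measurable_pi_apply j).comp (measurable_pi_apply r)

theorem measurableSet_strictAnti_levels : MeasurableSet {y : GTArray n | ∀ r, StrictAnti (y r)} := by
  simp only [StrictAnti, Set.ofPred_forall]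
  exact .iInter fun r => .iInter fun a => .iInter fun b => .iInter fun _ =>
    measurableSet_lt (measurable_array_apply r b) (measurable_array_apply r a)

theorem measurableSet_strictGT : MeasurableSet (strictGT n) := by
  refine measurableSet_strictAnti_levels.inter
    (s₂ := {y | ∀ (r : ℕ) (h : r + 1 < n) (j : Fin (r + 1)), y ⟨r, by omega⟩ j <
      y ⟨r + 1, h⟩ j.castSucc ∧ y ⟨r + 1, h⟩ j.succ ≤ y ⟨r, by omega⟩ j}) ?_
  simp only [Set.ofPred_forall, Set.ofPred_and]
  exact .iInter fun r => .iInter fun h => .iInter fun j =>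
    (measurableSet_lt (measurable_array_apply _ _) (measurable_array_apply _ _)).inter
    (measurableSet_le (measurable_array_apply _ _) (measurable_array_apply _ _))

theorem measurableSet_closedGT : MeasurableSet (closedGT n) := by
  have h : MeasurableSet {y : GTArray n | ∀ r, Antitone (y r)} := by
    simp only [Antitone, Set.ofPred_forall]
    exact .iInter fun r => .iInter fun a => .iInter fun b => .iInter fun _ =>
      measurableSet_le (measurable_array_apply r b) (measurable_array_apply r a)
  refine h.inter
    (s₂ := {y | ∀ (r : ℕ) (h : r + 1 < n) (j : Fin (r + 1)), y ⟨r, by omega⟩ j ≤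
      y ⟨r + 1, h⟩ j.castSucc ∧ y ⟨r + 1, h⟩ j.succ ≤ y ⟨r, by omega⟩ j}) ?_
  simp only [Set.ofPred_forall, Set.ofPred_and]
  exact .iInter fun r => .iInter fun h => .iInter fun j =>
    (measurableSet_le (measurable_array_apply _ _) (measurable_array_apply _ _)).inter
    (measurableSet_le (measurable_array_apply _ _) (measurable_array_apply _ _))

theorem measurable_topDet {φ : Fin n → ℝ → ℝ} (hφ : ∀ i, Measurable (φ i)) :
    Measurable (topDet φ) := by
  unfold topDet
  simp only [Matrix.det_apply]
  refine Finset.measurable_sum _ fun σ _ => Measurable.const_smul (Finset.measurable_prod _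
    fun i _ => (hφ _).comp (measurable_array_apply _ _)) _

theorem measurable_gtParticles : Measurable (gtParticles (n := n)) :=
  measurable_pi_lambda _ fun p => measurable_const.prodMk (measurable_array_apply p.1 p.2)

theorem strictGT_subset_closedGT : strictGT n ⊆ closedGT n := fun _ hy =>
  ⟨fun r => (hy.1 r).antitone, fun r h j => ⟨(hy.2 r h j).1.le, (hy.2 r h j).2⟩⟩

theorem volume_array_eq (p p' : Σ r : Fin n, Fin (r.val + 1)) (hp : p ≠ p') :
    volume {y : GTArray n | y p.1 p.2 = y p'.1 p'.2} = 0 := by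
  classical
  let ev : (Σ r : Fin n, Fin (r.val + 1)) → GTArray n →ₗ[ℝ] ℝ := fun p =>
    (LinearMap.proj p.2 : (Fin (p.1.val + 1) → ℝ) →ₗ[ℝ] ℝ).comp
      (LinearMap.proj p.1 : GTArray n →ₗ[ℝ] (Fin (p.1.val + 1) → ℝ))
  have h := Measure.addHaar_submodule (volume : Measure (GTArray n))
    (LinearMap.ker (ev p - ev p')) (fun h => ?_)
  · convert h using 2
    ext y
    simp [ev, sub_eq_zero]
  · have h1 : (fun r j => if (⟨r, j⟩ : Σ r : Fin n, Fin (r.val + 1)) = p then (1 : ℝ) else 0 :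
        GTArray n) ∈ LinearMap.ker (ev p - ev p') := by rw [h]; trivial
    simp [ev, Ne.symm hp] at h1

/-- A closed pattern that is not strict has two coinciding particles, so it lies in one of finitely
many hyperplanes. -/
theorem volume_closedGT_diff_strictGT : volume (closedGT n \ strictGT n) = 0 := by
  refine measure_mono_null (t := ⋃ p : Σ r : Fin n, Fin (r.val + 1),
    ⋃ p' : Σ r : Fin n, Fin (r.val + 1), ⋃ _ : p ≠ p', {y : GTArray n | y p.1 p.2 = y p'.1 p'.2}) ?_
    ?_
  · rintro y ⟨hy, hy'⟩
    by_contra hne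
    simp only [Set.mem_iUnion, not_exists] at hne
    have hne' : ∀ p p' : Σ r : Fin n, Fin (r.val + 1), p ≠ p' → y p.1 p.2 ≠ y p'.1 p'.2 :=
      fun p p' hp h => hne p p' hp h
    refine hy' ⟨fun r a b hab => lt_of_le_of_ne (hy.1 r hab.le) ?_, fun r h j =>
      ⟨lt_of_le_of_ne (hy.2 r h j).1 ?_, (hy.2 r h j).2⟩⟩
    · exact hne' ⟨r, b⟩ ⟨r, a⟩ fun e => hab.ne' (by simpa using e)
    · exact hne' ⟨⟨r, by omega⟩, j⟩ ⟨⟨r + 1, h⟩, j.castSucc⟩ fun e => by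
        have := congrArg (fun p : Σ r : Fin n, Fin (r.val + 1) => p.1.val) e
        simp at this
  · simp only [measure_iUnion_null_iff]
    exact fun p p' hp => volume_array_eq p p' hp

theorem closedGT_ae_eq_strictGT : closedGT n =ᵐ[volume] strictGT n :=
  (ae_eq_set.2 ⟨volume_closedGT_diff_strictGT, by
    rw [Set.sdiff_eq_empty.2 strictGT_subset_closedGT, measure_empty]⟩)

theorem gtMeasure_compl_strictGT (φ : Fin n → ℝ → ℝ) (Z : ℝ) :
    gtMeasure φ Z (strictGT n)ᶜ = 0 := by
  refine withDensity_absolutelyContinuous _ _ ?_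
  rw [Measure.restrict_apply measurableSet_strictGT.compl, Set.inter_comm]
  exact volume_closedGT_diff_strictGT

theorem gtMeasure_apply {φ : Fin n → ℝ → ℝ} (Z : ℝ) {A : Set (GTArray n)} (hA : MeasurableSet A) :
    gtMeasure φ Z A = ∫⁻ y in A ∩ strictGT n, ENNReal.ofReal (Z⁻¹ * topDet φ y) := by
  rw [gtMeasure, withDensity_apply _ hA, Measure.restrict_restrict hA]
  exact setLIntegral_congr ((Filter.EventuallyEq.refl _ A).inter closedGT_ae_eq_strictGT)

theorem topDet_integrableOn_strictGT {φ : Fin n → ℝ → ℝ} (hφ : ∀ i, Measurable (φ i))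
    (hnonneg : ∀ᵐ y ∂((volume : Measure (GTArray n)).restrict (closedGT n)), 0 ≤ topDet φ y)
    {Z : ℝ} (hZ : 0 < Z) [hprob : IsProbabilityMeasure (gtMeasure φ Z)] :
    IntegrableOn (fun y => Z⁻¹ * topDet φ y) (strictGT n) := by
  have h0 : 0 ≤ᵐ[volume.restrict (strictGT n)] fun y => Z⁻¹ * topDet φ y := by
    filter_upwards [ae_restrict_of_ae_restrict_of_subset strictGT_subset_closedGT hnonneg] with y hy
    exact mul_nonneg (inv_nonneg.2 hZ.le) hy
  refine ⟨((measurable_topDet hφ).const_mul _).aestronglyMeasurable, ?_⟩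
  rw [hasFiniteIntegral_iff_ofReal h0]
  have := gtMeasure_apply (φ := φ) Z (A := Set.univ) MeasurableSet.univ
  rw [Set.univ_inter] at this
  rw [← this]
  exact measure_lt_top _ _

theorem gtMeasure_toReal {φ : Fin n → ℝ → ℝ} (hφ : ∀ i, Measurable (φ i))
    (hnonneg : ∀ᵐ y ∂((volume : Measure (GTArray n)).restrict (closedGT n)), 0 ≤ topDet φ y)
    {Z : ℝ} (hZ : 0 < Z) {A : Set (GTArray n)} (hA : MeasurableSet A) :
    (gtMeasure φ Z A).toReal = ∫ y in A ∩ strictGT n, Z⁻¹ * topDet φ y := by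
  rw [gtMeasure_apply Z hA, integral_eq_lintegral_of_nonneg_ae]
  · filter_upwards [ae_restrict_of_ae_restrict_of_subset
      (Set.inter_subset_right.trans strictGT_subset_closedGT) hnonneg] with y hy
    exact mul_nonneg (inv_nonneg.2 hZ.le) hy
  · exact ((measurable_topDet hφ).const_mul _).aestronglyMeasurable

/-- The tuple of the particles of `y` with the labels `i`. -/
def particleTuple (i : Fin (Fintype.card (Σ r : Fin n, Fin (r.val + 1))) ↪
    (Σ r : Fin n, Fin (r.val + 1))) (y : GTArray n) :
    Fin (Fintype.card (Σ r : Fin n, Fin (r.val + 1))) → Fin n × ℝ :=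
  fun k => gtParticles y (i k)

variable (i : Fin (Fintype.card (Σ r : Fin n, Fin (r.val + 1))) ↪ (Σ r : Fin n, Fin (r.val + 1)))

theorem bijective_labels : Function.Bijective i :=
  (Fintype.bijective_iff_injective_and_card i).2 ⟨i.injective, by simp⟩

theorem measurableEmbedding_particleTuple : MeasurableEmbedding (particleTuple i) := by
  refine Measurable.measurableEmbedding (measurable_pi_lambda _ fun k =>
    (measurable_pi_apply (i k)).comp measurable_gtParticles) fun y y' h => ?_
  funext r j
  obtain ⟨k, hk⟩ := (bijective_labels i).2 ⟨r, j⟩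
  have := congrArg Prod.snd (congrFun h k)
  simp only [particleTuple, gtParticles] at this
  rwa [hk] at this

theorem levelMeasure_restrict_apply (r : Fin n) {s : Set (Fin n × ℝ)} (hs : MeasurableSet s) :
    (levelMeasure n).restrict ({r} ×ˢ Set.univ) s = volume {x : ℝ | (r, x) ∈ s} := by
  have hm : MeasurableSet (s ∩ {r} ×ˢ (Set.univ : Set ℝ)) :=
    hs.inter ((measurableSet_singleton r).prod MeasurableSet.univ)
  rw [Measure.restrict_apply hs, levelMeasure_eq_sum, Measure.finsetSum_apply,
    Finset.sum_eq_single r]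
  · rw [Measure.map_apply measurable_prodMk_left hm]
    congr 1
    ext x
    simp
  · intro t _ ht
    rw [Measure.map_apply measurable_prodMk_left hm]
    convert measure_empty (μ := (volume : Measure ℝ))
    ext x
    simp [ht]
  · simp

/-- A labelling relabels the real coordinates and prescribes the level of every point; on that
choice of levels the product of the level measures is Lebesgue measure. -/
theorem measurePreserving_particleTuple :
    MeasurePreserving (particleTuple i) volume ((Measure.pi fun _ => levelMeasure n).restrict
      (Set.univ.pi fun k => {(i k).1} ×ˢ Set.univ)) := by
  refine ⟨(measurableEmbedding_particleTuple i).measurable, ?_⟩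
  rw [Measure.restrict_pi_pi]
  symm
  refine Measure.pi_eq fun s hs => ?_
  let e := Equiv.ofBijective i (bijective_labels i)
  rw [(measurableEmbedding_particleTuple i).map_apply]
  have hpre : particleTuple i ⁻¹' (Set.univ.pi s) = Set.univ.pi fun r => Set.univ.pi
      fun j : Fin (r.val + 1) => {x : ℝ | (r, x) ∈ s (e.symm ⟨r, j⟩)} := by
    ext y
    simp only [Set.mem_preimage, Set.mem_univ_pi, particleTuple, Set.mem_ofPred_eq]
    constructor
    · intro h r j
      have := h (e.symm ⟨r, j⟩)
      have e1 : i (e.symm ⟨r, j⟩) = ⟨r, j⟩ := e.apply_symm_apply _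
      rwa [e1] at this
    · intro h k
      have := h (i k).1 (i k).2
      have e1 : e.symm ⟨(i k).1, (i k).2⟩ = k := e.symm_apply_apply _
      rwa [e1] at this
  rw [hpre, volume_pi_pi]
  simp only [volume_pi_pi]
  rw [← Fintype.prod_sigma' (fun r (j : Fin (r.val + 1)) =>
    volume {x : ℝ | (r, x) ∈ s (e.symm ⟨r, j⟩)}), ← e.prod_comp]
  refine Finset.prod_congr rfl fun k _ => ?_
  rw [levelMeasure_restrict_apply _ (hs k)]
  have e1 : e.symm ⟨(e k).1, (e k).2⟩ = k := e.symm_apply_apply _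
  rw [e1]
  rfl

theorem gtParticles_eq_gtParticles {y y' : GTArray n} {p p' : Σ r : Fin n, Fin (r.val + 1)}
    (h : gtParticles y p = gtParticles y' p') :
    ∃ j : Fin (p.1.val + 1), p' = ⟨p.1, j⟩ ∧ y' p.1 j = y p.1 p.2 := by
  obtain ⟨r, j⟩ := p
  obtain ⟨r', j'⟩ := p'
  obtain ⟨h1, h2⟩ := Prod.ext_iff.1 h
  simp only [gtParticles] at h1 h2
  subst h1
  exact ⟨j', rfl, h2.symm⟩

theorem particleTuple_sorted_unique
    {i i' : Fin (Fintype.card (Σ r : Fin n, Fin (r.val + 1))) ↪ (Σ r : Fin n, Fin (r.val + 1))}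
    {y y' : GTArray n} (hy : ∀ r, StrictAnti (y r)) (hy' : ∀ r, StrictAnti (y' r))
    (h : particleTuple i y = particleTuple i' y') : i = i' := by
  have hle : ∀ {i i' : Fin (Fintype.card (Σ r : Fin n, Fin (r.val + 1))) ↪
      (Σ r : Fin n, Fin (r.val + 1))} {y y' : GTArray n}, particleTuple i y = particleTuple i' y' →
      ∀ r, Set.range (y r) ⊆ Set.range (y' r) := by
    rintro i i' y y' h r _ ⟨j, rfl⟩
    obtain ⟨k, hk⟩ := (bijective_labels i).2 ⟨r, j⟩
    have hk2 : gtParticles y (i k) = gtParticles y' (i' k) := congrFun h k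
    rw [hk] at hk2
    obtain ⟨j', -, hj'⟩ := gtParticles_eq_gtParticles hk2
    exact ⟨j', hj'⟩
  have hyy : y = y' := funext fun r =>
    (StrictAnti.range_inj (hy r) (hy' r)).1 ((hle h r).antisymm (hle h.symm r))
  subst hyy
  ext1 k
  obtain ⟨j', h1, h2⟩ := gtParticles_eq_gtParticles (congrFun h k)
  rw [h1, (hy _).injective h2]

end Arrays

/-- The determinant of the kernel at the maximal number of points is proportional to the density of
the tuples of particles. -/
theorem det_density_particleTuple {n : ℕ} {φ : Fin (n + 1) → ℝ → ℝ} (hφ : ∀ i, Measurable (φ i))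
    (hnonneg : ∀ᵐ y ∂((volume : Measure (GTArray (n + 1))).restrict (closedGT (n + 1))),
      0 ≤ topDet φ y)
    {Z : ℝ} (hZ : 0 < Z) [hprob : IsProbabilityMeasure (gtMeasure φ Z)] :
    ∃ c : ℝ, Integrable
      (fun w : Fin (Fintype.card (Σ r : Fin (n + 1), Fin (r.val + 1))) → Fin (n + 1) × ℝ =>
        (kernelMatrix (extendedKernel φ) w).det) (Measure.pi fun _ => levelMeasure (n + 1)) ∧
      ∀ B : Set (Fin (Fintype.card (Σ r : Fin (n + 1), Fin (r.val + 1))) → Fin (n + 1) × ℝ),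
        MeasurableSet B → ∫ w in B, (kernelMatrix (extendedKernel φ) w).det
          ∂(Measure.pi fun _ => levelMeasure (n + 1)) =
          c * (tupleMeasure (gtMeasure φ Z) gtParticles
            (Fintype.card (Σ r : Fin (n + 1), Fin (r.val + 1))) B).toReal := by
  obtain ⟨c, hc⟩ := det_extendedKernel_particles_of_strictAnti φ
  set N := Fintype.card (Σ r : Fin (n + 1), Fin (r.val + 1)) with hN
  set F : (Fin N → Fin (n + 1) × ℝ) → ℝ := fun w => (kernelMatrix (extendedKernel φ) w).det with hF
  set S : Set (GTArray (n + 1)) := {y | ∀ r, StrictAnti (y r)} with hS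
  have hSm : MeasurableSet S := measurableSet_strictAnti_levels
  set ν : Measure (Fin N → Fin (n + 1) × ℝ) := Measure.pi fun _ => levelMeasure (n + 1)
  set T : (Fin N ↪ (Σ r : Fin (n + 1), Fin (r.val + 1))) → Set (Fin N → Fin (n + 1) × ℝ) :=
    fun i => Set.univ.pi fun k => {(i k).1} ×ˢ Set.univ
  have himage : ∀ i A, particleTuple i '' A ⊆ T i := by
    rintro i A _ ⟨y, -, rfl⟩ k -
    exact ⟨rfl, trivial⟩
  have hFX : ∀ i, ∀ y ∈ S, F (particleTuple i y) =
      c * (strictGT (n + 1)).indicator (topDet φ) y := by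
    intro i y hy
    rw [← hc y hy, ← Matrix.det_submatrix_equiv_self (Equiv.ofBijective i (bijective_labels i))]
    rfl
  have hemb := fun i => measurableEmbedding_particleTuple (n := n + 1) i
  have hmp := fun i => measurePreserving_particleTuple (n := n + 1) i
  have hrestrict : ∀ i A, MeasurableSet A →
      (ν.restrict (T i)).restrict (particleTuple i '' A) = ν.restrict (particleTuple i '' A) := by
    intro i A hA
    rw [Measure.restrict_restrict ((hemb i).measurableSet_image.2 hA),
      Set.inter_eq_left.2 (himage i A)]
  -- The support of the determinant splits into disjoint pieces, one per labelling: a configuration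
  -- determines its sorted array and hence its labels.
  have hsum : F = fun w => ∑ i, (particleTuple i '' S).indicator F w := by
    funext w
    by_cases h0 : F w = 0
    · rw [h0, Finset.sum_eq_zero]
      intro i _
      by_cases hw : w ∈ particleTuple i '' S
      · rw [Set.indicator_of_mem hw, h0]
      · rw [Set.indicator_of_notMem hw]
    · obtain ⟨i, y, hy, hw⟩ := exists_array_of_det_ne_zero h0
      have hw' : particleTuple i y = w := funext hw
      rw [Finset.sum_eq_single i]
      · rw [Set.indicator_of_mem (show w ∈ particleTuple i '' S from ⟨y, hy, hw'⟩)]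
      · intro i' _ hne
        refine Set.indicator_of_notMem ?_ _
        rintro ⟨y', hy', hw''⟩
        exact hne (particleTuple_sorted_unique hy' hy (hw''.trans hw'.symm))
      · simp
  have hint : IntegrableOn ((strictGT (n + 1)).indicator (topDet φ)) Set.univ := by
    rw [integrableOn_univ, integrable_indicator_iff measurableSet_strictGT]
    refine ((topDet_integrableOn_strictGT hφ hnonneg hZ).const_mul Z).congr
      (.of_forall fun y => ?_)
    simp only []
    field_simp
  have hFi : ∀ i, IntegrableOn F (particleTuple i '' S) ν := by
    intro i
    rw [IntegrableOn, ← hrestrict i S hSm]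
    refine ((hmp i).integrableOn_image (hemb i)).2 ?_
    refine IntegrableOn.congr_fun ((hint.mono_set (Set.subset_univ S)).const_mul c)
      (fun y hy => (hFX i y hy).symm) hSm
  have hFi' : ∀ i, Integrable ((particleTuple i '' S).indicator F) ν := fun i =>
    (integrable_indicator_iff ((hemb i).measurableSet_image.2 hSm)).2 (hFi i)
  -- `c` comes from the determinant at arrays, and `Z` undoes the factor `Z⁻¹` in the density.
  refine ⟨c * Z, ?_, fun B hB => ?_⟩
  · rw [hsum]
    exact integrable_finsetSum _ fun i _ => hFi' i
  · have h1 : ∫ w in B, F w ∂ν = ∑ i, ∫ w in B, (particleTuple i '' S).indicator F w ∂ν := by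
      conv_lhs => rw [hsum]
      exact integral_finsetSum _ fun i _ => (hFi' i).integrableOn
    have h2 : ∀ i, ∫ w in B, (particleTuple i '' S).indicator F w ∂ν =
        c * Z * (gtMeasure φ Z (particleTuple i ⁻¹' B)).toReal := by
      intro i
      have hpm : MeasurableSet (particleTuple i ⁻¹' B) := (hemb i).measurable hB
      rw [setIntegral_indicator ((hemb i).measurableSet_image.2 hSm), Set.inter_comm,
        ← Set.image_inter_preimage, ← hrestrict i _ (hSm.inter hpm),
        (hmp i).setIntegral_image_emb (hemb i),
        setIntegral_congr_fun (hSm.inter hpm) (fun y hy => hFX i y hy.1),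
        integral_const_mul, setIntegral_indicator measurableSet_strictGT,
        gtMeasure_toReal hφ hnonneg hZ hpm, integral_const_mul]
      have h3 : S ∩ particleTuple i ⁻¹' B ∩ strictGT (n + 1) =
          particleTuple i ⁻¹' B ∩ strictGT (n + 1) := by
        rw [Set.inter_comm S (particleTuple i ⁻¹' B), Set.inter_assoc,
          (Set.inter_eq_right.2 fun y hy => hy.1 : S ∩ strictGT (n + 1) = strictGT (n + 1))]
      rw [h3]
      field_simp
    rw [h1]
    simp only [h2]
    rw [← Finset.mul_sum, tupleMeasure, lintegral_finsetSum _ fun i _ => ?_, ENNReal.toReal_sum]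
    · congr 1
      refine Finset.sum_congr rfl fun i _ => ?_
      rw [← lintegral_indicator_one ((hemb i).measurable hB)]
      rfl
    · intro i _
      have : ∫⁻ y, B.indicator (fun _ => (1 : ℝ≥0∞)) (fun k => gtParticles y (i k))
          ∂(gtMeasure φ Z) = gtMeasure φ Z (particleTuple i ⁻¹' B) := by
        rw [← lintegral_indicator_one ((hemb i).measurable hB)]
        rfl
      rw [this]
      exact measure_ne_top _ _
    · exact (measurable_const.indicator hB).comp (hemb i).measurable

/-! Moments. -/

/-- Induction on the number of roots. For two different admissible roots `t`, `t'` the difference of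
`h (x - t) x^l` and `h (x - t') x^l` is a nonzero multiple of `h x^l`; adding `t h x^l` to the first
then raises the degree by one. Nonzero measures without atoms supply the two roots. -/
theorem integrable_mul_pow_of_ae {m : ℕ} : ∀ (ν : Fin m → Measure ℝ) [∀ i, SigmaFinite (ν i)]
    [∀ i, NullSingletonClass (ν i)] [∀ i, NeZero (ν i)] (h : ℝ → ℝ),
    (∀ᵐ z ∂(Measure.pi ν), Integrable fun x => h x * ∏ i, (x - z i)) →
    ∀ l ≤ m, Integrable fun x => h x * x ^ l := by
  induction m with
  | zero =>
    intro ν _ _ _ h hz l hl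
    obtain rfl : l = 0 := by omega
    rw [Measure.pi_of_empty ν] at hz
    simpa using hz
  | succ m ih =>
    intro ν _ _ _ h hz
    have hmp := (measurePreserving_piFinSuccAbove ν 0).symm
    have h1 := Measure.ae_ae_of_ae_prod (hmp.quasiMeasurePreserving.ae hz)
    have h2 : ∀ᵐ t ∂(ν 0), ∀ l ≤ m, Integrable fun x => h x * (x - t) * x ^ l := by
      filter_upwards [h1] with t ht
      refine ih (fun i => ν ((0 : Fin (m + 1)).succAbove i)) (fun x => h x * (x - t)) ?_
      filter_upwards [ht] with z hz
      refine hz.congr (.of_forall fun x => ?_)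
      simp only [Fin.prod_univ_succ, MeasurableEquiv.piFinSuccAbove_symm_apply,
        Fin.insertNthEquiv_apply]
      simp [mul_assoc]
    obtain ⟨t, ht⟩ := h2.exists
    obtain ⟨t', ht', hne⟩ := (h2.and (compl_mem_ae_iff.2 (measure_singleton (μ := ν 0) t))).exists
    have hne' : t' - t ≠ 0 := sub_ne_zero.2 fun e => hne (by simp [e])
    have h3 : ∀ l ≤ m, Integrable fun x => h x * x ^ l := by
      intro l hl
      refine (((ht l hl).sub (ht' l hl)).const_mul (t' - t)⁻¹).congr (.of_forall fun x => ?_)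
      simp only [Pi.sub_apply]
      field_simp
      ring
    intro l hl
    rcases Nat.eq_zero_or_pos l with rfl | hpos
    · exact h3 0 (Nat.zero_le _)
    · obtain ⟨l, rfl⟩ := Nat.exists_eq_add_of_le' hpos
      refine ((ht l (by omega)).add ((h3 l (by omega)).const_mul t)).congr (.of_forall fun x => ?_)
      simp only [Pi.add_apply]
      ring

/-! ### Generic points and the Vandermonde product -/

theorem volume_pi_eq {n : ℕ} {a b : Fin n} (hab : a ≠ b) :
    volume {y : Fin n → ℝ | y a = y b} = 0 := by
  have h := Measure.addHaar_submodule (volume : Measure (Fin n → ℝ))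
    (LinearMap.ker ((LinearMap.proj a : (Fin n → ℝ) →ₗ[ℝ] ℝ) - LinearMap.proj b)) (fun h => ?_)
  · convert h using 2
    ext y
    simp [sub_eq_zero]
  · have h1 : Pi.single a (1 : ℝ) ∈
      LinearMap.ker ((LinearMap.proj a : (Fin n → ℝ) →ₗ[ℝ] ℝ) - LinearMap.proj b) := by
      rw [h]; trivial
    simp [hab.symm] at h1

theorem ae_injective (n : ℕ) : ∀ᵐ y : Fin n → ℝ, Function.Injective y := by
  have h : ∀ᵐ y : Fin n → ℝ, ∀ a b : Fin n, a ≠ b → y a ≠ y b := by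
    rw [ae_all_iff]; intro a
    rw [ae_all_iff]; intro b
    by_cases hab : a = b
    · simp [hab]
    · filter_upwards [compl_mem_ae_iff.2 (volume_pi_eq hab)] with y hy _ using hy
  filter_upwards [h] with y hy a b hab
  by_contra hne
  exact hy a b hne hab

theorem vandermondeDelta_eq_det {n : ℕ} (y : Fin n → ℝ) :
    vandermondeDelta y = (Matrix.vandermonde (-y)).det := by
  rw [Matrix.det_vandermonde, vandermondeDelta]
  refine Finset.prod_congr rfl fun i _ => Finset.prod_congr rfl fun j _ => ?_
  simp; ring

theorem vandermondeDelta_ne_zero {n : ℕ} {y : Fin n → ℝ} (hy : Function.Injective y) :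
    vandermondeDelta y ≠ 0 := by
  rw [vandermondeDelta_eq_det, Matrix.det_vandermonde_ne_zero_iff]
  exact fun a b hab => hy (neg_injective hab)

theorem vandermondeDelta_comp_perm {n : ℕ} (y : Fin n → ℝ) (σ : Equiv.Perm (Fin n)) :
    vandermondeDelta (y ∘ σ) = (Equiv.Perm.sign σ : ℤ) * vandermondeDelta y := by
  rw [vandermondeDelta_eq_det, vandermondeDelta_eq_det, ← Matrix.det_permute]
  rfl

theorem vandermondeDelta_cons {n : ℕ} (x : ℝ) (z : Fin n → ℝ) :
    vandermondeDelta (Fin.cons x z : Fin (n + 1) → ℝ) = (∏ i, (x - z i)) * vandermondeDelta z := by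
  simp only [vandermondeDelta, Fin.prod_univ_succ, Fin.prod_Ioi_zero, Fin.prod_Ioi_succ,
    Fin.cons_zero, Fin.cons_succ]

theorem vandermondeDelta_insertNth {n : ℕ} (k : Fin (n + 1)) (x : ℝ) (z : Fin n → ℝ) :
    vandermondeDelta (k.insertNth x z : Fin (n + 1) → ℝ) =
      (Equiv.Perm.sign k.cycleRange : ℤ) * ((∏ i, (x - z i)) * vandermondeDelta z) := by
  have h1 : (k.insertNth x z : Fin (n + 1) → ℝ) = (Fin.cons x z : Fin (n + 1) → ℝ) ∘ k.cycleRange := by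
    funext i
    simp
  rw [h1, vandermondeDelta_comp_perm, vandermondeDelta_cons]

/-- By Fubini `Φ_n` is integrable in the coordinate `k` for almost all values `z` of the others.
Where the other `φ_i` do not vanish, division by the factors free of `x` leaves `φ_k(x) ∏ (x -
z_i)`, and such `z` have positive measure as no `φ_i` is null. -/
theorem integrable_moment {n : ℕ} {φ : Fin (n + 1) → ℝ → ℝ} (hφ : ∀ i, Measurable (φ i))
    (hΦ : Integrable (PhiFn φ)) (hne : ∀ i, ¬ φ i =ᵐ[volume] 0) (k : Fin (n + 1)) :
    Integrable fun x => (1 + |x|) ^ n * φ k x := by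
  have hpow : ∀ l ≤ n, Integrable fun x => φ k x * x ^ l := by
    let S : Fin n → Set ℝ := fun i => {x | φ (k.succAbove i) x ≠ 0}
    have hS : ∀ i, MeasurableSet (S i) := fun i =>
      (hφ _) (measurableSet_singleton (0 : ℝ)).compl
    have hnz : ∀ i, NeZero ((volume : Measure ℝ).restrict (S i)) := fun i => ⟨fun h => by
      rw [Measure.restrict_eq_zero] at h
      exact hne _ h⟩
    refine integrable_mul_pow_of_ae (fun i => volume.restrict (S i)) (φ k) ?_
    rw [← Measure.restrict_pi_pi, ae_restrict_iff' (MeasurableSet.univ_pi hS)]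
    have hmp := (volume_preserving_piFinSuccAbove (fun _ : Fin (n + 1) => ℝ) k).symm
    have h1 := ((hmp.integrable_comp_emb (MeasurableEquiv.measurableEmbedding _)).2 hΦ).prod_left_ae
    filter_upwards [h1, ae_injective n] with z hz hinj hzS
    have hprod : (∏ i, φ (k.succAbove i) (z i)) ≠ 0 :=
      Finset.prod_ne_zero_iff.2 fun i _ => hzS i trivial
    have hΔ := vandermondeDelta_ne_zero hinj
    have hs : ((Equiv.Perm.sign k.cycleRange : ℤ) : ℝ) ≠ 0 := by
      simp
    refine (hz.const_mul (((Equiv.Perm.sign k.cycleRange : ℤ) : ℝ) *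
      (∏ i, φ (k.succAbove i) (z i)) * vandermondeDelta z)⁻¹).congr (.of_forall fun x => ?_)
    show _ * PhiFn φ (k.insertNth x z : Fin (n + 1) → ℝ) = _
    simp only [PhiFn, vandermondeDelta_insertNth, Fin.prod_univ_succAbove _ k,
        Fin.insertNth_apply_same, Fin.insertNth_apply_succAbove]
    field_simp
  have habs : ∀ l ≤ n, Integrable fun x => φ k x * |x| ^ l := by
    intro l hl
    refine (hpow l hl).norm.mono (((hφ k).mul (by fun_prop)).aestronglyMeasurable)
      (.of_forall fun x => ?_)
    simp
  have e : (fun x => (1 + |x|) ^ n * φ k x) = fun x =>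
      ∑ l ∈ Finset.range (n + 1), (n.choose l : ℝ) * (φ k x * |x| ^ l) := by
    funext x
    rw [add_comm (1 : ℝ), add_pow, Finset.sum_mul]
    exact Finset.sum_congr rfl fun l _ => by simp; ring
  rw [e]
  exact integrable_finsetSum _ fun l hl => (habs l (by simpa [Nat.lt_succ_iff] using hl)).const_mul _

/-! The determinant of the moments. -/

theorem integral_det_of_rows {n : ℕ} {f : Fin n → Fin n → ℝ → ℝ}
    (hf : ∀ i q, Integrable (f i q)) :
    Integrable (fun y : Fin n → ℝ => (Matrix.of fun i q => f i q (y i)).det) ∧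
      ∫ y : Fin n → ℝ, (Matrix.of fun i q => f i q (y i)).det =
        (Matrix.of fun i q => ∫ x, f i q x).det := by
  have e : ∀ y : Fin n → ℝ, (Matrix.of fun i q => f i q (y i)).det =
      ∑ σ : Equiv.Perm (Fin n), ((Equiv.Perm.sign σ : ℤ) : ℝ) * ∏ i, f i (σ i) (y i) := by
    intro y
    rw [← Matrix.det_transpose, Matrix.det_apply']
    rfl
  have hi : ∀ σ : Equiv.Perm (Fin n), Integrable fun y : Fin n → ℝ =>
      ((Equiv.Perm.sign σ : ℤ) : ℝ) * ∏ i, f i (σ i) (y i) := fun σ =>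
    (Integrable.fintype_prod fun i => hf i (σ i)).const_mul _
  simp only [e]
  refine ⟨integrable_finsetSum _ fun σ _ => hi σ, ?_⟩
  rw [integral_finsetSum _ fun σ _ => hi σ, ← Matrix.det_transpose, Matrix.det_apply']
  refine Finset.sum_congr rfl fun σ _ => ?_
  rw [integral_const_mul, volume_pi, integral_fintype_prod_eq_prod]
  rfl

/-- The matrix of the normalized monomials of degree less than `n`. -/
noncomputable def monomialMatrix {n : ℕ} (y : Fin n → ℝ) : Matrix (Fin n) (Fin n) ℝ :=
  Matrix.of fun i q => levelMonomial q (n - 1) (y i)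

theorem vandermondeDelta_eq_const_mul_det (n : ℕ) : ∃ c : ℝ, c ≠ 0 ∧ ∀ y : Fin n → ℝ,
    vandermondeDelta y = c * (monomialMatrix y).det := by
  -- Signs come from evaluating the Vandermonde matrix at `-y`, factorials from normalized
  -- monomials, and the reversal from their decreasing degrees `n - 1 - q`.
  refine ⟨(∏ q : Fin n, (-1 : ℝ) ^ q.val * (q.val.factorial : ℝ)) *
    ((Equiv.Perm.sign (Fin.revPerm : Equiv.Perm (Fin n)) : ℤ) : ℝ), ?_, fun y => ?_⟩
  · refine mul_ne_zero (Finset.prod_ne_zero_iff.2 fun q _ => mul_ne_zero (by simp) (by positivity))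
      (by simp)
  · rw [vandermondeDelta_eq_det, mul_assoc, ← Matrix.det_permute', ← Matrix.det_mul_row]
    congr 1
    ext i q
    have h1 : (n - 1 - (n - (q + 1)) : ℕ) = q := by omega
    simp only [Matrix.vandermonde_apply, Pi.neg_apply, Matrix.of_apply, Matrix.submatrix_apply,
      monomialMatrix, levelMonomial, Fin.revPerm_apply, Fin.val_rev, id, h1]
    rw [if_pos (by omega), neg_pow]
    field_simp

section Nonvanishing

variable {n : ℕ} {φ : Fin (n + 1) → ℝ → ℝ}

theorem ae_topLevel {p : (Fin (n + 1) → ℝ) → Prop} (hp : ∀ᵐ v, p v) :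
    ∀ᵐ y : GTArray (n + 1), p (topLevel y) :=
  (Measure.quasiMeasurePreserving_eval (μ := fun r : Fin (n + 1) =>
    (volume : Measure (Fin (r.val + 1) → ℝ))) (Fin.last n)).ae hp

theorem not_ae_det_eq_zero {Z : ℝ} [hprob : IsProbabilityMeasure (gtMeasure φ Z)] :
    ¬ ∀ᵐ v : Fin (n + 1) → ℝ, (Matrix.of fun i j => φ i (v j)).det = 0 := by
  intro h
  have h1 := gtMeasure_apply (φ := φ) Z (A := Set.univ) MeasurableSet.univ
  have h2 : ∫⁻ y in Set.univ ∩ strictGT (n + 1), ENNReal.ofReal (Z⁻¹ * topDet φ y) = 0 := by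
    rw [← lintegral_zero (μ := volume.restrict (Set.univ ∩ strictGT (n + 1)))]
    refine lintegral_congr_ae (ae_restrict_of_ae ?_)
    filter_upwards [ae_topLevel h] with y hy
    rw [topDet, hy]
    simp
  rw [measure_univ, h2] at h1
  exact one_ne_zero h1

theorem not_ae_eq_zero {Z : ℝ} [hprob : IsProbabilityMeasure (gtMeasure φ Z)] (i : Fin (n + 1)) :
    ¬ φ i =ᵐ[volume] 0 := by
  intro h
  refine not_ae_det_eq_zero (φ := φ) (Z := Z) ?_
  have h1 : ∀ᵐ v : Fin (n + 1) → ℝ, ∀ j, φ i (v j) = 0 := by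
    rw [ae_all_iff]
    exact fun j => (Measure.quasiMeasurePreserving_eval (μ := fun _ : Fin (n + 1) =>
      (volume : Measure ℝ)) j).ae h
  filter_upwards [h1] with v hv
  exact Matrix.det_eq_zero_of_row_eq_zero i hv

end Nonvanishing

/-! Arrays with a given top level. -/

section Fibres

variable {n : ℕ}

/-- The arrays with strict inequalities throughout. -/
def openGT (n : ℕ) : Set (GTArray (n + 1)) :=
  {y | (∀ r, ∀ a b, a < b → y r b < y r a) ∧ ∀ (r : Fin n) (j : Fin (r.val + 1)),
    y ⟨r, by omega⟩ j < y ⟨r + 1, by omega⟩ j.castSucc ∧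
      y ⟨r + 1, by omega⟩ j.succ < y ⟨r, by omega⟩ j}

theorem isOpen_openGT : IsOpen (openGT n) := by
  have hc : ∀ (r : Fin (n + 1)) (j : Fin (r.val + 1)), Continuous fun y : GTArray (n + 1) => y r j :=
    fun r j => (continuous_apply j).comp (continuous_apply r)
  unfold openGT
  simp only [Set.ofPred_forall, Set.ofPred_and]
  refine IsOpen.inter ?_ ?_
  · exact isOpen_iInter_of_finite fun r => isOpen_iInter_of_finite fun a =>
      isOpen_iInter_of_finite fun b => isOpen_iInter_of_finite fun _ => isOpen_lt (hc _ _) (hc _ _)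
  · exact isOpen_iInter_of_finite fun r => isOpen_iInter_of_finite fun j =>
      (isOpen_lt (hc _ _) (hc _ _)).inter (isOpen_lt (hc _ _) (hc _ _))

theorem openGT_subset_closedGT : openGT n ⊆ closedGT (n + 1) := fun y hy =>
  ⟨fun r => StrictAnti.antitone fun a b hab => hy.1 r a b hab, fun r h j =>
    ⟨(hy.2 ⟨r, by omega⟩ j).1.le, (hy.2 ⟨r, by omega⟩ j).2.le⟩⟩

/-- The averages of neighbouring terms. -/
noncomputable def neighbourMean (c : ℕ → ℝ) (k : ℕ) : ℝ := (c k + c (k + 1)) / 2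

theorem neighbourMean_strictAnti {c : ℕ → ℝ} (hc : StrictAnti c) : StrictAnti (neighbourMean c) := by
  refine strictAnti_nat_of_succ_lt fun k => ?_
  have h1 := hc (Nat.lt_succ_self k)
  have h2 := hc (Nat.lt_succ_self (k + 1))
  simp only [neighbourMean]
  simp only [Nat.succ_eq_add_one] at h1 h2
  linarith

theorem exists_mem_openGT {a : Fin (n + 1) → ℝ} (ha : StrictAnti a) :
    ∃ y ∈ openGT n, y (Fin.last n) = a := by
  -- The top level is continued to an infinite strictly decreasing sequence, so that the averaging
  -- of neighbours can be iterated without boundary cases.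
  let b : ℕ → ℝ := fun k => if h : k < n + 1 then a ⟨k, h⟩ else a (Fin.last n) - ((k : ℝ) - n)
  have hb : StrictAnti b := by
    refine strictAnti_nat_of_succ_lt fun k => ?_
    simp only [b]
    split_ifs with h1 h2 h2
    · exact ha (Fin.mk_lt_mk.2 (Nat.lt_succ_self k))
    · omega
    · have : k = n := by omega
      subst this
      push_cast
      have : a (Fin.last k) = a ⟨k, h2⟩ := rfl
      linarith
    · push_cast; linarith
  have hit : ∀ m, StrictAnti (neighbourMean^[m] b) := by
    intro m
    induction m with
    | zero => exact hb
    | succ m ih => rw [Function.iterate_succ_apply']; exact neighbourMean_strictAnti ih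
  refine ⟨fun r j => neighbourMean^[n - r] b j, ⟨fun r i j hij => hit _ hij, fun r j => ?_⟩, ?_⟩
  · have h1 : n - r.val = (n - (r.val + 1)) + 1 := by omega
    have h2 : neighbourMean^[n - r] b j.val = (neighbourMean^[n - (r.val + 1)] b j.val +
        neighbourMean^[n - (r.val + 1)] b (j.val + 1)) / 2 := by
      rw [h1, Function.iterate_succ_apply']
      rfl
    have h3 := hit (n - (r.val + 1)) (Nat.lt_succ_self j.val)
    simp only [Nat.succ_eq_add_one] at h3
    simp only [h2, Fin.val_castSucc, Fin.val_succ]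
    constructor <;> linarith
  · funext j
    show neighbourMean^[n - n] b j = a j
    rw [Nat.sub_self]
    exact dif_pos j.isLt

/-- Above every strictly decreasing top level, the strict patterns form a nonempty open fibre, which
has positive measure. Fubini then passes the property to almost every top level. -/
theorem ae_of_ae_closedGT {p : (Fin (n + 1) → ℝ) → Prop}
    (hp : ∀ᵐ y ∂((volume : Measure (GTArray (n + 1))).restrict (closedGT (n + 1))),
      p (topLevel y)) : ∀ᵐ v : Fin (n + 1) → ℝ, StrictAnti v → p v := by
  rw [ae_restrict_iff' measurableSet_closedGT] at hp
  let e := MeasurableEquiv.piFinSuccAbove (fun r : Fin (n + 1) => Fin (r.val + 1) → ℝ) (Fin.last n)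
  have hmp := (volume_preserving_piFinSuccAbove
    (fun r : Fin (n + 1) => Fin (r.val + 1) → ℝ) (Fin.last n)).symm
  have h1 := Measure.ae_ae_of_ae_prod (hmp.quasiMeasurePreserving.ae hp)
  filter_upwards [h1] with v hv hanti
  have hcont : Continuous fun z : ((j : Fin n) → Fin (((Fin.last n).succAbove j).val + 1) → ℝ) =>
      e.symm (v, z) := by
    show Continuous fun z => ((Fin.last n).insertNth v z :
      (r : Fin (n + 1)) → Fin (r.val + 1) → ℝ)
    fun_prop
  have hopen : IsOpen {z | e.symm (v, z) ∈ openGT n} := isOpen_openGT.preimage hcont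
  have hne : {z | e.symm (v, z) ∈ openGT n}.Nonempty := by
    obtain ⟨y, hy, hyv⟩ := exists_mem_openGT hanti
    refine ⟨(e y).2, ?_⟩
    have : (v, (e y).2) = e y := Prod.ext (by rw [← hyv]; rfl) rfl
    simpa [this] using hy
  have hpos := hopen.measure_pos volume hne
  obtain ⟨z, hz1, hz2⟩ := ((frequently_ae_mem_iff.2 hpos.ne').and_eventually hv).exists
  have h2 := hz2 (openGT_subset_closedGT hz1)
  have h3 : topLevel (e.symm (v, z)) = v := by
    show e.symm (v, z) (Fin.last n) = v
    exact Fin.insertNth_apply_same (α := fun r : Fin (n + 1) => Fin (r.val + 1) → ℝ) _ _ _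
  rwa [← h3]

end Fibres

/-! The normalization constant. -/

section Normalization

variable {n : ℕ} {φ : Fin (n + 1) → ℝ → ℝ}

theorem PhiFn_eq_const_mul_det : ∃ c : ℝ, c ≠ 0 ∧ ∀ y : Fin (n + 1) → ℝ, ∀ ψ : Fin (n + 1) → ℝ → ℝ,
    PhiFn ψ y = c * (Matrix.of fun i q : Fin (n + 1) => levelMonomial q n (y i) * ψ i (y i)).det := by
  obtain ⟨c, hc, h⟩ := vandermondeDelta_eq_const_mul_det (n + 1)
  refine ⟨c, hc, fun y ψ => ?_⟩
  rw [PhiFn, h, mul_left_comm, ← Matrix.det_mul_column]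
  congr 2
  ext i q
  simp [monomialMatrix, mul_comm]

theorem integrable_levelMonomial_mul (hφ : ∀ i, Measurable (φ i))
    (hd : ∀ i, Integrable fun x => (1 + |x|) ^ n * φ i x) (i q : Fin (n + 1)) :
    Integrable fun x => levelMonomial q n x * φ i x :=
  integrable_mul_of_moment (hφ i) (hd i) (continuous_levelMonomial q n).measurable (C := 1)
    (fun y => by simpa using abs_levelMonomial_le q n y) (by omega)

theorem BConst_eq_const_mul_det (hφ : ∀ i, Measurable (φ i))
    (hd : ∀ i, Integrable fun x => (1 + |x|) ^ n * φ i x) :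
    ∃ c : ℝ, c ≠ 0 ∧ BConst φ = c * (momentMatrix φ).det ∧ ∀ y ψ,
      PhiFn ψ y = c * (Matrix.of fun i q : Fin (n + 1) => levelMonomial q n (y i) * ψ i (y i)).det := by
  obtain ⟨c, hc, h⟩ := PhiFn_eq_const_mul_det (n := n)
  refine ⟨c, hc, ?_, h⟩
  simp only [BConst, h]
  rw [integral_const_mul, (integral_det_of_rows (f := fun i q x => levelMonomial q n x * φ i x)
    (integrable_levelMonomial_mul hφ hd)).2]
  rfl

/-- The Leibniz expansion of the first factor gives `Φ_n` for permuted `φ`. The sign from permuting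
the rows of the moment matrix cancels the Leibniz sign, so all terms agree. -/
theorem integral_det_mul_vandermondeDelta (hφ : ∀ i, Measurable (φ i))
    (hd : ∀ i, Integrable fun x => (1 + |x|) ^ n * φ i x) :
    ∃ c : ℝ, Integrable (fun y => (Matrix.of fun i j => φ i (y j)).det * vandermondeDelta y) ∧
      ∫ y, (Matrix.of fun i j => φ i (y j)).det * vandermondeDelta y =
        c * (momentMatrix φ).det := by
  obtain ⟨c, hc, h⟩ := PhiFn_eq_const_mul_det (n := n)
  have e : ∀ y : Fin (n + 1) → ℝ, (Matrix.of fun i j => φ i (y j)).det * vandermondeDelta y =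
      ∑ σ : Equiv.Perm (Fin (n + 1)), ((Equiv.Perm.sign σ : ℤ) : ℝ) *
        (c * (Matrix.of fun i q : Fin (n + 1) => levelMonomial q n (y i) * φ (σ i) (y i)).det) := by
    intro y
    rw [Matrix.det_apply', Finset.sum_mul]
    refine Finset.sum_congr rfl fun σ _ => ?_
    rw [← h y fun i => φ (σ i), PhiFn, mul_assoc]
    rfl
  have hi := fun σ : Equiv.Perm (Fin (n + 1)) =>
    integral_det_of_rows (f := fun i q x => levelMonomial q n x * φ (σ i) x)
      (fun i q => integrable_levelMonomial_mul hφ hd (σ i) q)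
  simp only [e]
  refine ⟨∑ σ : Equiv.Perm (Fin (n + 1)), c, integrable_finsetSum _ fun σ _ =>
    ((hi σ).1.const_mul c).const_mul _, ?_⟩
  rw [integral_finsetSum _ fun σ _ => ((hi σ).1.const_mul c).const_mul _, Finset.sum_mul]
  refine Finset.sum_congr rfl fun σ _ => ?_
  rw [integral_const_mul, integral_const_mul, (hi σ).2]
  have h1 : (Matrix.of fun i q : Fin (n + 1) => ∫ x, levelMonomial q n x * φ (σ i) x).det =
      ((Equiv.Perm.sign σ : ℤ) : ℝ) * (momentMatrix φ).det := by
    rw [← Matrix.det_permute]; rfl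
  have h2 : (((Equiv.Perm.sign σ : ℤ) : ℝ)) * ((Equiv.Perm.sign σ : ℤ) : ℝ) = 1 := by
    rw [← Int.cast_mul, Int.units_coe_mul_self]; simp
  rw [h1]
  linear_combination (c * (momentMatrix φ).det) * h2

theorem vandermondeDelta_pos {y : Fin (n + 1) → ℝ} (hy : StrictAnti y) : 0 < vandermondeDelta y :=
  Finset.prod_pos fun _ _ => Finset.prod_pos fun _ hj => sub_pos.2 (hy (Finset.mem_Ioi.1 hj))

theorem exists_perm_strictAnti {y : Fin (n + 1) → ℝ} (hy : Function.Injective y) :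
    ∃ σ : Equiv.Perm (Fin (n + 1)), StrictAnti (y ∘ σ) := by
  refine ⟨Tuple.sort (-y), fun a b hab => ?_⟩
  have h1 := (Tuple.monotone_sort (-y)).strictMono_of_injective
    ((neg_injective.comp hy).comp (Tuple.sort (-y)).injective) hab
  simpa using h1

/-- Both factors are antisymmetric, so their product is symmetric and the sorted case decides. -/
theorem det_mul_vandermondeDelta_nonneg
    (hnonneg : ∀ᵐ y ∂((volume : Measure (GTArray (n + 1))).restrict (closedGT (n + 1))),
      0 ≤ topDet φ y) :
    ∀ᵐ y : Fin (n + 1) → ℝ, 0 ≤ (Matrix.of fun i j => φ i (y j)).det * vandermondeDelta y := by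
  have h1 := ae_of_ae_closedGT (p := fun v => 0 ≤ (Matrix.of fun i j => φ i (v j)).det) hnonneg
  have h2 : ∀ᵐ y : Fin (n + 1) → ℝ, ∀ σ : Equiv.Perm (Fin (n + 1)), StrictAnti (y ∘ σ) →
      0 ≤ (Matrix.of fun i j => φ i ((y ∘ σ) j)).det := by
    rw [ae_all_iff]
    intro σ
    have hσ := volume_measurePreserving_piCongrLeft (fun _ : Fin (n + 1) => ℝ) σ.symm
    have he : ∀ y : Fin (n + 1) → ℝ,
        MeasurableEquiv.piCongrLeft (fun _ : Fin (n + 1) => ℝ) σ.symm y = y ∘ σ := by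
      intro y
      funext i
      simp [MeasurableEquiv.piCongrLeft, Equiv.piCongrLeft_apply]
    have := hσ.quasiMeasurePreserving.ae h1
    simpa only [he] using this
  filter_upwards [h2, ae_injective (n + 1)] with y hy hinj
  obtain ⟨σ, hσ⟩ := exists_perm_strictAnti hinj
  have h3 := mul_nonneg (hy σ hσ) (vandermondeDelta_pos hσ).le
  have h4 : (Matrix.of fun i j => φ i ((y ∘ σ) j)).det =
      ((Equiv.Perm.sign σ : ℤ) : ℝ) * (Matrix.of fun i j => φ i (y j)).det := by
    rw [← Matrix.det_permute']; rfl
  have h5 : (((Equiv.Perm.sign σ : ℤ) : ℝ)) * ((Equiv.Perm.sign σ : ℤ) : ℝ) = 1 := by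
    rw [← Int.cast_mul, Int.units_coe_mul_self]; simp
  rw [h4, vandermondeDelta_comp_perm] at h3
  calc (0 : ℝ) ≤ _ := h3
    _ = _ := by linear_combination ((Matrix.of fun i j => φ i (y j)).det * vandermondeDelta y) * h5

/-- If the moment determinant vanished, so would the integral of the nonnegative function `det [φ_i
(y_j)] Δ(y)`. Then `det [φ_i (y_j)]` would be null, contradicting total mass one. -/
theorem det_momentMatrix_ne_zero (hφ : ∀ i, Measurable (φ i))
    (hd : ∀ i, Integrable fun x => (1 + |x|) ^ n * φ i x)
    (hnonneg : ∀ᵐ y ∂((volume : Measure (GTArray (n + 1))).restrict (closedGT (n + 1))),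
      0 ≤ topDet φ y) {Z : ℝ} [hprob : IsProbabilityMeasure (gtMeasure φ Z)] :
    (momentMatrix φ).det ≠ 0 := by
  intro h0
  obtain ⟨c, hi, h⟩ := integral_det_mul_vandermondeDelta hφ hd
  rw [h0, mul_zero, integral_eq_zero_iff_of_nonneg_ae (det_mul_vandermondeDelta_nonneg hnonneg) hi]
    at h
  refine not_ae_det_eq_zero (φ := φ) (Z := Z) ?_
  filter_upwards [h, ae_injective (n + 1)] with y hy hinj
  exact (mul_eq_zero.1 hy).resolve_right (vandermondeDelta_ne_zero hinj)

end Normalization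

/-! The integral formula for the kernel. -/

theorem deriv_levelMonomial (q s : ℕ) : deriv (levelMonomial q (s + 1)) = levelMonomial q s := by
  funext v
  unfold levelMonomial
  rcases lt_trichotomy q (s + 1) with h | h | h
  · have h1 : (s + 1 - q : ℕ) = (s - q) + 1 := by omega
    simp only [show q ≤ s + 1 by omega, show q ≤ s by omega, if_true, h1]
    rw [deriv_div_const, deriv_pow_field, Nat.factorial_succ]
    have : ((s - q).factorial : ℝ) ≠ 0 := by positivity
    push_cast
    field_simp
  · subst h
    simp
  · simp only [show ¬ q ≤ s + 1 by omega, show ¬ q ≤ s by omega, if_false]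
    simp

theorem iteratedDeriv_levelMonomial (q s d : ℕ) :
    iteratedDeriv d (levelMonomial q (s + d)) = levelMonomial q s := by
  induction d with
  | zero => simp
  | succ d ih => rw [iteratedDeriv_succ', ← add_assoc, deriv_levelMonomial, ih]

section Formula

variable {n : ℕ}

theorem levelMonomial_eq_sum_lagrange {y : Fin (n + 1) → ℝ} (hy : Function.Injective y) {q : ℕ}
    (hq : q ≤ n) (u w : ℝ) : levelMonomial q n (w - u) =
      ∑ i, levelMonomial q n (y i - u) * ∏ k ∈ Finset.univ.erase i, (w - y k) / (y i - y k) := by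
  let f : Polynomial ℝ := Polynomial.C ((n - q).factorial : ℝ)⁻¹ *
    (Polynomial.X - Polynomial.C u) ^ (n - q)
  have hf : ∀ x, f.eval x = levelMonomial q n (x - u) := by
    intro x
    simp [f, levelMonomial, hq]
    ring
  have hdeg : f.degree < (Finset.univ : Finset (Fin (n + 1))).card := by
    rw [Polynomial.degree_C_mul (by positivity), Polynomial.degree_pow, Polynomial.degree_X_sub_C, Finset.card_univ, Fintype.card_fin]
    simp only [nsmul_eq_mul, mul_one]
    exact_mod_cast (by omega : n - q < n + 1)
  have h := congrArg (Polynomial.eval w) (Lagrange.eq_interpolate hy.injOn hdeg)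
  rw [hf, Lagrange.interpolate_apply, Polynomial.eval_finsetSum] at h
  rw [h]
  refine Finset.sum_congr rfl fun i _ => ?_
  rw [Polynomial.eval_mul, Polynomial.eval_C, hf, Lagrange.basis, Polynomial.eval_prod]
  congr 1
  refine Finset.prod_congr rfl fun k _ => ?_
  simp [Lagrange.basisDivisor]
  ring

theorem levelMonomial_eq_sum_lagrangeDeriv {y : Fin (n + 1) → ℝ} (hy : Function.Injective y) {q : ℕ}
    (hq : q ≤ n) (s : Fin (n + 1)) (u v : ℝ) : levelMonomial q s (v - u) =
      ∑ i, levelMonomial q n (y i - u) * lagrangeDeriv (s.val + 1) y i v := by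
  have h1 : (fun w => levelMonomial q n (w - u)) = fun w => ∑ i, levelMonomial q n (y i - u) *
      ∏ k ∈ Finset.univ.erase i, (w - y k) / (y i - y k) :=
    funext fun w => levelMonomial_eq_sum_lagrange hy hq u w
  have h2 := congrFun (congrArg (iteratedDeriv (n + 1 - (s.val + 1))) h1) v
  have h3 : s.val + (n + 1 - (s.val + 1)) = n := by omega
  have h4 : iteratedDeriv (n + 1 - (s.val + 1)) (fun w => levelMonomial q n (w - u)) v =
      levelMonomial q s (v - u) := by
    rw [iteratedDeriv_comp_sub_const]
    have h5 := iteratedDeriv_levelMonomial q s (n + 1 - (s.val + 1))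
    rw [h3] at h5
    simp only [h5]
  rw [← h4, h2, iteratedDeriv_fun_sum fun i _ => by fun_prop]
  refine Finset.sum_congr rfl fun i _ => ?_
  rw [iteratedDeriv_const_mul_field]
  rfl

/-- Replacing the row `j` of a matrix of monomials brings in the Lagrange basis. -/
theorem det_updateRow_monomialMatrix {y : Fin (n + 1) → ℝ} (hy : Function.Injective y)
    (s j : Fin (n + 1)) (v : ℝ) :
    ((monomialMatrix y).updateRow j fun q : Fin (n + 1) => levelMonomial q s v).det =
      lagrangeDeriv (s.val + 1) y j v * (monomialMatrix y).det := by
  have : (fun q : Fin (n + 1) => levelMonomial q s v) =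
      ∑ i, lagrangeDeriv (s.val + 1) y i v • monomialMatrix y i := by
    funext q
    have := levelMonomial_eq_sum_lagrangeDeriv hy (q := q) (by omega) s 0 v
    simp only [sub_zero] at this
    rw [this, Finset.sum_apply]
    refine Finset.sum_congr rfl fun i _ => ?_
    simp [monomialMatrix, mul_comm]
  rw [this, Matrix.det_updateRow_sum]
  rfl

variable {φ : Fin (n + 1) → ℝ → ℝ}

/-- The integrals of `Φ_n(y) ∑_j g(y_j) L_j(v)`, with the derivatives of the Lagrange basis. -/
theorem integral_PhiFn_mul_sum_lagrangeDeriv (hφ : ∀ i, Measurable (φ i))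
    (hd : ∀ i, Integrable fun x => (1 + |x|) ^ n * φ i x) (hdet : (momentMatrix φ).det ≠ 0)
    {g : ℝ → ℝ} (hg : Measurable g) {C : ℝ} {a : ℕ} (hC : ∀ x, |g x| ≤ C * (1 + |x|) ^ a)
    (ha : a ≤ n) (s : Fin (n + 1)) (v : ℝ) :
    Integrable (fun y => PhiFn φ y * ∑ j, g (y j) * lagrangeDeriv (s.val + 1) y j v) ∧
      (BConst φ)⁻¹ * ∫ y, PhiFn φ y * ∑ j, g (y j) * lagrangeDeriv (s.val + 1) y j v =
        ∑ q : Fin (n + 1), (∑ j, (momentMatrix φ)⁻¹ q j * ∫ x, g x * φ j x) *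
          levelMonomial q s v := by
  obtain ⟨c, hc, hB, hΦ⟩ := BConst_eq_const_mul_det hφ hd
  -- Row `j` is replaced by the monomials at `v` with weight `g (y_j)`. Each row still depends on
  -- its own variable only, so the determinant integrates row by row.
  let f : Fin (n + 1) → Fin (n + 1) → Fin (n + 1) → ℝ → ℝ := fun j i q x =>
    if i = j then levelMonomial q s v * (g x * φ j x) else levelMonomial q n x * φ i x
  have hgi : ∀ j, Integrable fun x => g x * φ j x := fun j =>
    integrable_mul_of_moment (hφ j) (hd j) hg hC ha
  have hfi : ∀ j i q, Integrable (f j i q) := by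
    intro j i q
    by_cases h : i = j
    · simp only [f, h, if_true]
      exact (hgi j).const_mul _
    · simp only [f, h, if_false]
      exact integrable_levelMonomial_mul hφ hd i q
  have hf := fun j => integral_det_of_rows (hfi j)
  have e : (fun y => PhiFn φ y * ∑ j, g (y j) * lagrangeDeriv (s.val + 1) y j v) =ᵐ[volume]
      fun y => ∑ j, c * (Matrix.of fun i q => f j i q (y i)).det := by
    filter_upwards [ae_injective (n + 1)] with y hy
    rw [Finset.mul_sum]
    refine Finset.sum_congr rfl fun j _ => ?_
    have h1 : (Matrix.of fun i q => levelMonomial (q : Fin (n + 1)) n (y i) * φ i (y i)).det =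
        (∏ i, φ i (y i)) * (monomialMatrix y).det := by
      rw [← Matrix.det_mul_column]
      congr 1; ext i q; simp [monomialMatrix, mul_comm]
    have h2 : (Matrix.of fun i q => f j i q (y i)).det = (∏ i, (if i = j then g (y j) else 1) *
        φ i (y i)) * (lagrangeDeriv (s.val + 1) y j v * (monomialMatrix y).det) := by
      rw [← det_updateRow_monomialMatrix hy, ← Matrix.det_mul_column]
      congr 1; ext i q
      by_cases h : i = j
      · subst h; simp [f]; ring
      · simp [f, h, monomialMatrix, mul_comm]
    rw [hΦ, h1, h2, Finset.prod_mul_distrib, Finset.prod_ite_eq']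
    simp only [Finset.mem_univ, if_true]
    ring
  have hi : Integrable fun y : Fin (n + 1) → ℝ => ∑ j, c * (Matrix.of fun i q => f j i q (y i)).det :=
    integrable_finsetSum _ fun j _ => (hf j).1.const_mul c
  refine ⟨hi.congr e.symm, ?_⟩
  rw [integral_congr_ae e, integral_finsetSum _ fun j _ => (hf j).1.const_mul c, hB]
  -- Cramer's rule: the moment matrix with row `j` replaced.
  have h3 : ∀ j, (Matrix.of fun i q => ∫ x, f j i q x).det = (∫ x, g x * φ j x) *
      ∑ q : Fin (n + 1), (momentMatrix φ).adjugate q j * levelMonomial q s v := by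
    intro j
    have h4 : (Matrix.of fun i q => ∫ x, f j i q x) = (momentMatrix φ).updateRow j
        ((∫ x, g x * φ j x) • fun q : Fin (n + 1) => levelMonomial q s v) := by
      ext i q
      by_cases h : i = j
      · subst h; simp [f, integral_const_mul, mul_comm]
      · simp [f, h, momentMatrix]
    rw [h4, Matrix.det_updateRow_smul, ← Matrix.cramer_transpose_apply,
      Matrix.cramer_eq_adjugate_mulVec, ← Matrix.adjugate_transpose]
    rfl
  have h5 : ∀ q j, (momentMatrix φ)⁻¹ q j =
      (momentMatrix φ).det⁻¹ * (momentMatrix φ).adjugate q j := by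
    intro q j
    rw [Matrix.inv_def, Ring.inverse_eq_inv']
    rfl
  simp only [integral_const_mul, (hf _).2, h3, h5, Finset.sum_mul, Finset.mul_sum]
  rw [Finset.sum_comm]
  refine Finset.sum_congr rfl fun q _ => Finset.sum_congr rfl fun j _ => ?_
  field_simp

theorem permChamber_ae_eq_univ : permChamber (n + 1) =ᵐ[volume] Set.univ := by
  rw [ae_eq_univ]
  refine measure_mono_null (fun y hy => ?_) (ae_iff.1 (ae_injective (n + 1)))
  intro hinj
  obtain ⟨σ, hσ⟩ := exists_perm_strictAnti hinj
  refine hy (Set.mem_iUnion.2 ⟨σ⁻¹, y ∘ σ, hσ, ?_⟩)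
  funext i
  simp

end Formula

section KernelFormula

variable {n : ℕ} {φ : Fin (n + 1) → ℝ → ℝ}

theorem abs_sub_pow_div_factorial_le (k : ℕ) (u x : ℝ) :
    |(x - u) ^ k / (k.factorial : ℝ)| ≤ (1 + |u|) ^ k * (1 + |x|) ^ k := by
  have h1 : |x - u| ≤ (1 + |u|) * (1 + |x|) := by
    have := abs_sub x u
    nlinarith [abs_nonneg x, abs_nonneg u]
  have h2 : (1 : ℝ) ≤ (k.factorial : ℝ) := by exact_mod_cast k.factorial_pos
  rw [abs_div, abs_pow, Nat.abs_cast, ← mul_pow]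
  exact (div_le_self (by positivity) h2).trans (by gcongr)

theorem abs_ite_mul_sub_pow_le (p : Prop) [Decidable p] (k : ℕ) (u x : ℝ) :
    |(if p then (1 : ℝ) else 0) * ((x - u) ^ k / (k.factorial : ℝ))| ≤
      (1 + |u|) ^ k * (1 + |x|) ^ k := by
  refine le_trans ?_ (abs_sub_pow_div_factorial_le k u x)
  split_ifs <;> simp

theorem measurable_upperWeight (u v : ℝ) (k : ℕ) : Measurable fun x : ℝ =>
    (if v ≤ u ∧ u < x then (1 : ℝ) else 0) * ((x - u) ^ k / (k.factorial : ℝ)) :=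
  (Measurable.ite ((MeasurableSet.const _).inter measurableSet_Ioi) measurable_const
    measurable_const).mul (by fun_prop)

theorem measurable_lowerWeight (u v : ℝ) (k : ℕ) : Measurable fun x : ℝ =>
    (if u < v ∧ x ≤ u then (1 : ℝ) else 0) * ((x - u) ^ k / (k.factorial : ℝ)) :=
  (Measurable.ite ((MeasurableSet.const _).inter measurableSet_Iic) measurable_const
    measurable_const).mul (by fun_prop)

theorem integral_upperIntegrand (hφ : ∀ i, Measurable (φ i))
    (hd : ∀ i, Integrable fun x => (1 + |x|) ^ n * φ i x) (hdet : (momentMatrix φ).det ≠ 0)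
    (r s : Fin (n + 1)) (u v : ℝ) :
    IntegrableOn (upperIntegrand φ (r.val + 1) (s.val + 1) u v) (permChamber (n + 1)) volume ∧
      (BConst φ)⁻¹ * (∫ y in permChamber (n + 1), upperIntegrand φ (r.val + 1) (s.val + 1) u v y) =
        ∑ q : Fin (n + 1), (∑ j, (momentMatrix φ)⁻¹ q j *
          ∫ x, (if v ≤ u ∧ u < x then (1 : ℝ) else 0) *
            ((x - u) ^ (n + 1 - (r.val + 1) - 1) / ((n + 1 - (r.val + 1) - 1).factorial : ℝ)) *
            φ j x) * levelMonomial q s v := by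
  rw [IntegrableOn, Measure.restrict_congr_set permChamber_ae_eq_univ, Measure.restrict_univ]
  exact integral_PhiFn_mul_sum_lagrangeDeriv hφ hd hdet (measurable_upperWeight u v _)
    (fun x => abs_ite_mul_sub_pow_le _ _ u x) (by omega) s v

theorem integral_lowerIntegrand (hφ : ∀ i, Measurable (φ i))
    (hd : ∀ i, Integrable fun x => (1 + |x|) ^ n * φ i x) (hdet : (momentMatrix φ).det ≠ 0)
    (r s : Fin (n + 1)) (u v : ℝ) :
    IntegrableOn (lowerIntegrand φ (r.val + 1) (s.val + 1) u v) (permChamber (n + 1)) volume ∧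
      (BConst φ)⁻¹ * (∫ y in permChamber (n + 1), lowerIntegrand φ (r.val + 1) (s.val + 1) u v y) =
        ∑ q : Fin (n + 1), (∑ j, (momentMatrix φ)⁻¹ q j *
          ∫ x, (if u < v ∧ x ≤ u then (1 : ℝ) else 0) *
            ((x - u) ^ (n + 1 - (r.val + 1) - 1) / ((n + 1 - (r.val + 1) - 1).factorial : ℝ)) *
            φ j x) * levelMonomial q s v := by
  rw [IntegrableOn, Measure.restrict_congr_set permChamber_ae_eq_univ, Measure.restrict_univ]
  exact integral_PhiFn_mul_sum_lagrangeDeriv hφ hd hdet (measurable_lowerWeight u v _)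
    (fun x => abs_ite_mul_sub_pow_le _ _ u x) (by omega) s v

/-- The weight `(x - u)^k / k!` is a polynomial of degree at most `n`, so Lagrange interpolation
reproduces it. The sum against `Φ_n` no longer depends on `y`, and the integral is `B_n` times it.
-/
theorem sum_integral_pow_eq_levelMonomial (hφ : ∀ i, Measurable (φ i))
    (hd : ∀ i, Integrable fun x => (1 + |x|) ^ n * φ i x) (hdet : (momentMatrix φ).det ≠ 0)
    (hB : BConst φ ≠ 0) {k q : ℕ} (hk : k + q = n) (s : Fin (n + 1))
    (u v : ℝ) :
    ∑ q : Fin (n + 1), (∑ j, (momentMatrix φ)⁻¹ q j *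
      ∫ x, (x - u) ^ k / (k.factorial : ℝ) * φ j x) * levelMonomial q s v =
      levelMonomial q s (v - u) := by
  have h := (integral_PhiFn_mul_sum_lagrangeDeriv hφ hd hdet
    (g := fun x => (x - u) ^ k / (k.factorial : ℝ)) (by fun_prop)
    (fun x => abs_sub_pow_div_factorial_le k u x) (by omega) s v).2
  rw [← h]
  have e : (fun y => PhiFn φ y * ∑ j, (y j - u) ^ k / (k.factorial : ℝ) *
      lagrangeDeriv (s.val + 1) y j v) =ᵐ[volume]
      fun y => PhiFn φ y * levelMonomial q s (v - u) := by
    filter_upwards [ae_injective (n + 1)] with y hy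
    rw [levelMonomial_eq_sum_lagrangeDeriv hy (q := q) (by omega) s u v]
    congr 1
    refine Finset.sum_congr rfl fun j _ => ?_
    rw [levelMonomial, if_pos (by omega), show n - q = k by omega]
  rw [integral_congr_ae e, integral_mul_const]
  change (BConst φ)⁻¹ * (BConst φ * _) = _
  field_simp

theorem extendedKernel_eq_integral (hφ : ∀ i, Measurable (φ i))
    (hd : ∀ i, Integrable fun x => (1 + |x|) ^ n * φ i x) (hdet : (momentMatrix φ).det ≠ 0)
    (hB : BConst φ ≠ 0) (r s : Fin (n + 1)) (hr : r.val + 1 ≤ n)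
    (u v : ℝ) :
    extendedKernel φ (r, u) (s, v) =
      (BConst φ)⁻¹ *
        (∫ y in permChamber (n + 1), upperIntegrand φ (r.val + 1) (s.val + 1) u v y) -
      (BConst φ)⁻¹ *
        (∫ y in permChamber (n + 1), lowerIntegrand φ (r.val + 1) (s.val + 1) u v y) := by
  obtain ⟨k, hk⟩ : ∃ k, k + (r.val + 1) = n := ⟨n - (r.val + 1), by omega⟩
  rw [(integral_upperIntegrand hφ hd hdet r s u v).2, (integral_lowerIntegrand hφ hd hdet r s u v).2,
    show n + 1 - (r.val + 1) - 1 = k by omega]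
  have hp := sum_integral_pow_eq_levelMonomial hφ hd hdet hB hk s u v
  have i1 := fun j => integrable_mul_of_moment (hφ j) (hd j) (measurable_upperWeight u v k)
    (fun x => abs_ite_mul_sub_pow_le _ k u x) (by omega)
  have i2 := fun j => integrable_mul_of_moment (hφ j) (hd j) (measurable_lowerWeight u v k)
    (fun x => abs_ite_mul_sub_pow_le _ k u x) (by omega)
  have i3 := fun j => integrable_mul_of_moment (hφ j) (hd j)
    (g := fun x => (x - u) ^ k / (k.factorial : ℝ)) (by fun_prop)
    (fun x => abs_sub_pow_div_factorial_le k u x) (by omega)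
  -- This rests on `1_{u<x} - 1_{u<v} = 1_{v≤u<x} - 1_{x≤u<v}`: comparison of the steps at `x` and
  -- at `v` eliminates the base point.
  have key : ∀ j, ∫ x, splineKernel (k + 1) u x * φ j x =
      (∫ x, (if v ≤ u ∧ u < x then (1 : ℝ) else 0) * ((x - u) ^ k / (k.factorial : ℝ)) * φ j x) -
      (∫ x, (if u < v ∧ x ≤ u then (1 : ℝ) else 0) * ((x - u) ^ k / (k.factorial : ℝ)) * φ j x) +
      stepKernel u v * ∫ x, (x - u) ^ k / (k.factorial : ℝ) * φ j x := by
    intro j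
    rw [← integral_const_mul, ← integral_sub (i1 j) (i2 j),
      ← integral_add ((i1 j).sub' (i2 j)) ((i3 j).const_mul _)]
    congr 1
    funext x
    simp only [splineKernel, stepKernel]
    split_ifs <;> first | ring1 | (exfalso; grind)
  -- The leftover multiple of `stepKernel u v` sums to this expression, so it cancels the term
  -- `-W_{s-r}` of the kernel.
  have hW : splineKernel (s - r) u v = stepKernel u v * levelMonomial (r.val + 1) s (v - u) := by
    rcases Nat.eq_zero_or_pos (s - r : ℕ) with h0 | h0
    · rw [h0, splineKernel, levelMonomial, if_neg (by omega), mul_zero]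
    · obtain ⟨d, hsd⟩ := Nat.exists_eq_add_of_le' h0
      rw [hsd, splineKernel, levelMonomial, if_pos (by omega),
        show s.val - (r.val + 1) = d by omega]
  rw [extendedKernel, hW, ← hp]
  simp only [dualFunction, splineTransform]
  rw [show n + 1 - 1 - r.val = k + 1 by omega]
  simp only [Nat.succ_ne_zero, if_false, key]
  rw [Finset.mul_sum, ← Finset.sum_neg_distrib, ← Finset.sum_add_distrib,
    ← Finset.sum_sub_distrib]
  refine Finset.sum_congr rfl fun q _ => ?_
  simp only [mul_add, mul_sub, Finset.sum_add_distrib, Finset.sum_sub_distrib]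
  simp only [mul_left_comm _ (stepKernel u v), ← Finset.mul_sum]
  ring

end KernelFormula

/-! ### Assembly of the theorem -/

theorem mainTheorem3 (n : ℕ) (hn : 1 ≤ n) (φ : Fin n → ℝ → ℝ)
    (hφ : ∀ i, Measurable (φ i))
    (hΦ : Integrable (PhiFn φ) (volume : Measure (Fin n → ℝ)))
    (hnonneg : ∀ᵐ y ∂((volume : Measure (GTArray n)).restrict (closedGT n)), 0 ≤ topDet φ y)
    (Z : ℝ) (hZ : 0 < Z) (hprob : IsProbabilityMeasure (gtMeasure φ Z)) :
    BConst φ ≠ 0 ∧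
    gtMeasure φ Z (strictGT n)ᶜ = 0 ∧
    (∀ r s : Fin n, r.val + 1 ≤ n - 1 → ∀ u v : ℝ,
      IntegrableOn (upperIntegrand φ (r.val + 1) (s.val + 1) u v) (permChamber n) volume ∧
      IntegrableOn (lowerIntegrand φ (r.val + 1) (s.val + 1) u v) (permChamber n) volume) ∧
    ∃ K : Fin n × ℝ → Fin n × ℝ → ℝ,
      (∀ r s : Fin n, r.val + 1 ≤ n - 1 → ∀ u v : ℝ,
        K (r, u) (s, v) =
          (BConst φ)⁻¹ *
            (∫ y in permChamber n, upperIntegrand φ (r.val + 1) (s.val + 1) u v y) -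
          (BConst φ)⁻¹ *
            (∫ y in permChamber n, lowerIntegrand φ (r.val + 1) (s.val + 1) u v y)) ∧
      IsDeterminantal (gtMeasure φ Z) gtParticles (levelMeasure n) K := by
  obtain ⟨n, rfl⟩ := Nat.exists_eq_add_of_le' hn
  have hd := integrable_moment hφ hΦ (not_ae_eq_zero (Z := Z))
  have hdet : (momentMatrix φ).det ≠ 0 := det_momentMatrix_ne_zero hφ hd hnonneg (Z := Z)
  have hB : BConst φ ≠ 0 := by
    obtain ⟨c, hc, h, -⟩ := BConst_eq_const_mul_det hφ hd
    rw [h]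
    exact mul_ne_zero hc hdet
  obtain ⟨c, hdens⟩ := det_density_particleTuple hφ hnonneg hZ
  exact ⟨hB, gtMeasure_compl_strictGT φ Z, fun r s _ u v =>
    ⟨(integral_upperIntegrand hφ hd hdet r s u v).1, (integral_lowerIntegrand hφ hd hdet r s u v).1⟩,
    extendedKernel φ, fun r s hr u v => extendedKernel_eq_integral hφ hd hdet hB r s hr u v,
    isDeterminantal_of_det_density (l := fun w => (w.1 : ℝ)) _ measurable_gtParticles
      (fun w z => integral_extendedKernel_mul hφ hd hdet w z)
      (integral_extendedKernel_diag hφ hd hdet) hdens⟩
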